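/- **Theorem (dependence of fixed points on parameters).** Let $\mathbb K$ be a valued field, i.e. a field with a non-trivial absolute value (not assumed complete). Let $E$ be a Hausdorff topological $\mathbb K$-vector space and $F$ a Banach space over $\mathbb K$. Let $P\subseteq E$ be a subset with dense interior (the interior of $P$ is dense in $P$), let $U\subseteq F$ be open, and let $f\colon P\times U\to F$ be continuous such that the maps $f_p:=f(p,\cdot)\colon U\to F$ form a uniform family of contractions: there is $\theta\in[0,1[$ with $\|f_p(x)-f_p(y)\|\le\theta\|x-y\|$ for all $p\in P$ and $x,y\in U$. Then: (a) The set $Q$ of all $p\in P$ such that $f_p$ has a fixed point $x_p\in U$ (which is then unique) is open in $P$. (b) Let $k\in\mathbb N_0\cup\{\infty\}$. If $f$ is $C^k$ (resp. $SC^k$, resp. $LC^k$), then the map $\phi\colon Q\to U$, $\phi(p):=x_p$, is $C^k$ (resp. $SC^k$, resp. $LC^k$). Here the following notions are used, for Hausdorff topological $\mathbb K$-vector spaces $X,Y$, a subset $V\subseteq X$ with dense interior, and a map $g\colon V\to Y$. - Put $V^{[1]}:=\{(x,y,t)\in V\times X\times\mathbb K: x+ty\in V\}$. The map $g$ is $C^0$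 if it is continuous. It is $C^1$ if it is continuous and there is a (necessarily unique) continuous map $g^{[1]}\colon V^{[1]}\to Y$ with $g^{[1]}(x,y,t)=\frac{g(x+ty)-g(x)}{t}$ whenever $t\ne0$. For $k\ge 2$ it is $C^k$ if it is $C^1$ and $g^{[1]}$ is $C^{k-1}$, and it is $C^\infty$ if it is $C^k$ for all $k\in\mathbb N_0$. Put $g^{[0]}:=g$, $V^{[0]}:=V$ and $g^{[j+1]}:=(g^{[j]})^{[1]}$, defined on $V^{[j+1]}:=(V^{[j]})^{[1]}$. - A gauge on $X$ is an upper semicontinuous function $\gamma\colon X\to[0,\infty[$ with $\gamma(tx)=|t|\gamma(x)$ for all $t\in\mathbb K$, $x\in X$. - $g$ is Lipschitz continuous if for every $x_0\in V$ and every gauge $\gamma$ on $Y$ there are a gauge $\eta$ on $X$ and $\delta>0$ such that $\gamma(g(y)-g(x))\le\eta(y-x)$ for all $x,y\in V$ with $\eta(x-x_0)<\delta$ and $\eta(y-x_0)<\delta$. - $g$ is strictly differentiable if for every $x\in V$ there is a continuous linear map $g'(x)\colon X\to Y$ such that for every gauge $\gamma$ on $Y$ there is a gauge $\eta$ on $X$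 with the property: for each $\varepsilon>0$ there is $\delta>0$ such that $\gamma\big(g(z)-g(y)-g'(x)(z-y)\big)\le\varepsilon\,\eta(z-y)$ for all $y,z\in V$ with $\eta(z-x)<\delta$ and $\eta(y-x)<\delta$. - $g$ is $LC^k$ if it is $C^k$ and $g^{[j]}$ is Lipschitz continuous for all $j\in\mathbb N_0$ with $j\le k$. It is $SC^k$ if it is $C^k$ and $g^{[j]}$ is strictly differentiable for all $j\in\mathbb N_0$ with $j<k$. -/

import Mathlib

universe u v w

/-- `U` has dense interior: the interior of `U` is dense in `U`. -/
def HasDenseInterior {E : Type v} [TopologicalSpace E] (U : Set E) : Prop :=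
  U ⊆ closure (interior U)

/-- A gauge on a topological vector space over a valued field: an upper semicontinuous,
absolutely homogeneous function with values in `[0, ∞[`. -/
structure IsGauge (𝕜 : Type u) [NontriviallyNormedField 𝕜] {E : Type v} [AddCommGroup E]
    [Module 𝕜 E] [TopologicalSpace E] (γ : E → ℝ) : Prop where
  nonneg : ∀ x, 0 ≤ γ x
  smul : ∀ (t : 𝕜) (x : E), γ (t • x) = ‖t‖ * γ x
  usc : UpperSemicontinuous γ

/-- Lipschitz continuity (a local notion) of `f` on the set `U`, in terms of gauges. -/
def LipschitzContOn (𝕜 : Type u) [NontriviallyNormedField 𝕜] {E : Type v} [AddCommGroup E]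
    [Module 𝕜 E] [TopologicalSpace E] {F : Type w} [AddCommGroup F] [Module 𝕜 F]
    [TopologicalSpace F] (U : Set E) (f : E → F) : Prop :=
  ∀ x₀ ∈ U, ∀ γ : F → ℝ, IsGauge 𝕜 γ →
    ∃ η : E → ℝ, IsGauge 𝕜 η ∧ ∃ δ : ℝ, 0 < δ ∧
      ∀ x ∈ U, ∀ y ∈ U, η (x - x₀) < δ → η (y - x₀) < δ → γ (f y - f x) ≤ η (y - x)

/-- Strict differentiability of `f : U → F` at each point of `U`. -/
def StrictDiffOn (𝕜 : Type u) [NontriviallyNormedField 𝕜] {E : Type v} [AddCommGroup E]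
    [Module 𝕜 E] [TopologicalSpace E] {F : Type w} [AddCommGroup F] [Module 𝕜 F]
    [TopologicalSpace F] (U : Set E) (f : E → F) : Prop :=
  ∀ x ∈ U, ∃ f' : E →L[𝕜] F, ∀ γ : F → ℝ, IsGauge 𝕜 γ →
    ∃ η : E → ℝ, IsGauge 𝕜 η ∧ ∀ ε : ℝ, 0 < ε → ∃ δ : ℝ, 0 < δ ∧
      ∀ y ∈ U, ∀ z ∈ U, η (z - x) < δ → η (y - x) < δ →
        γ (f z - f y - f' (z - y)) ≤ ε * η (z - y)

/-- `U^{[1]} = {(x, y, t) ∈ U × E × 𝕜 : x + t y ∈ U}`. -/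
def dqDomain (𝕜 : Type u) [NontriviallyNormedField 𝕜] {E : Type v} [AddCommGroup E]
    [Module 𝕜 E] (U : Set E) : Set (E × E × 𝕜) :=
  {z | z.1 ∈ U ∧ z.1 + z.2.2 • z.2.1 ∈ U}

/-- `g` is (on `U^{[1]}`) the map `f^{[1]}`: it is continuous on `U^{[1]}` and extends the
directional difference quotient of `f : U → F`. -/
structure IsExtDiffQuot (𝕜 : Type u) [NontriviallyNormedField 𝕜] {E : Type v} [AddCommGroup E]
    [Module 𝕜 E] [TopologicalSpace E] {F : Type w} [AddCommGroup F] [Module 𝕜 F]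
    [TopologicalSpace F] (U : Set E) (f : E → F) (g : E × E × 𝕜 → F) : Prop where
  cont : ContinuousOn g (dqDomain 𝕜 U)
  eq : ∀ (x y : E) (t : 𝕜), t ≠ 0 → (x, y, t) ∈ dqDomain 𝕜 U →
    g (x, y, t) = t⁻¹ • (f (x + t • y) - f x)

/-- The three kinds of differentiability: `C^k`, `SC^k`, `LC^k`. -/
inductive DiffKind
  | C
  | SC
  | LC

/-- The condition that the kind imposes on `f^{[j]}` for a map of order `k`, where `r = k - j`:
continuity; in addition strict differentiability if `j < k` (for `SC^k`), respectively
Lipschitz continuity (for `LC^k`). -/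
def LevelCond (𝕜 : Type u) [NontriviallyNormedField 𝕜] {E : Type v} [AddCommGroup E]
    [Module 𝕜 E] [TopologicalSpace E] {F : Type w} [AddCommGroup F] [Module 𝕜 F]
    [TopologicalSpace F] (c : DiffKind) (r : ℕ) (U : Set E) (f : E → F) : Prop :=
  ContinuousOn f U ∧
    match c with
    | .C => True
    | .SC => 0 < r → StrictDiffOn 𝕜 U f
    | .LC => LipschitzContOn 𝕜 U f

/-- Recursion for maps of finite order `k`; the universe of `E` is at least the one of `𝕜`, so
that `E × E × 𝕜` lives in the same universe as `E`. -/
def IsDiffAux (𝕜 : Type u) [NontriviallyNormedField 𝕜] {F : Type w} [AddCommGroup F]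
    [Module 𝕜 F] [TopologicalSpace F] (c : DiffKind) :
    ℕ → ∀ {E : Type (max u v)} [AddCommGroup E] [Module 𝕜 E] [TopologicalSpace E],
      Set E → (E → F) → Prop
  | 0, _, _, _, _, U, f => LevelCond 𝕜 c 0 U f
  | k + 1, E, _, _, _, U, f => LevelCond 𝕜 c (k + 1) U f ∧
      ∃ g : E × E × 𝕜 → F, IsExtDiffQuot 𝕜 U f g ∧ IsDiffAux 𝕜 c k (dqDomain 𝕜 U) g

/-- `f : U → F` is of the given kind and finite order `k`. This is the same recursion as in
`IsDiffAux`, for `E` in an arbitrary universe: only the first step can change the universe. -/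
def IsDiffNat (𝕜 : Type u) [NontriviallyNormedField 𝕜] {E : Type v} [AddCommGroup E]
    [Module 𝕜 E] [TopologicalSpace E] {F : Type w} [AddCommGroup F] [Module 𝕜 F]
    [TopologicalSpace F] (c : DiffKind) (k : ℕ) (U : Set E) (f : E → F) : Prop :=
  match k with
  | 0 => LevelCond 𝕜 c 0 U f
  | k + 1 => LevelCond 𝕜 c (k + 1) U f ∧
      ∃ g : E × E × 𝕜 → F, IsExtDiffQuot 𝕜 U f g ∧
        IsDiffAux.{u, v, w} 𝕜 c k (dqDomain 𝕜 U) g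

/-- `f : U → F` is of the given kind and order `k ∈ ℕ₀ ∪ {∞}`. -/
def IsDiff (𝕜 : Type u) [NontriviallyNormedField 𝕜] {E : Type v} [AddCommGroup E]
    [Module 𝕜 E] [TopologicalSpace E] {F : Type w} [AddCommGroup F] [Module 𝕜 F]
    [TopologicalSpace F] (c : DiffKind) (k : ℕ∞) (U : Set E) (f : E → F) : Prop :=
  ∀ n : ℕ, (n : ℕ∞) ≤ k → IsDiffNat 𝕜 c n U f

/-- `(f(p, ·) : U → F)_{p ∈ P}` is a uniform family of contractions. -/
def IsUniformContractionFamily {E : Type v} {F : Type w} [NormedAddCommGroup F]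
    (P : Set E) (U : Set F) (f : E × F → F) : Prop :=
  ∃ θ : ℝ, 0 ≤ θ ∧ θ < 1 ∧ ∀ p ∈ P, ∀ x ∈ U, ∀ y ∈ U, ‖f (p, x) - f (p, y)‖ ≤ θ * ‖x - y‖

/-- The set `Q` of all `p ∈ P` such that `f(p, ·) : U → F` has a fixed point. -/
def fixedParams {E : Type v} {F : Type w} (P : Set E) (U : Set F) (f : E × F → F) : Set E :=
  {p | p ∈ P ∧ ∃ x ∈ U, f (p, x) = x}

-- Let φ(p) be the fixed point of f(p, ·). The estimate ‖φ(p) - φ(q)‖ ≤ (1-θ)⁻¹ ‖f(p, φ(q)) - f(q,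
-- φ(q))‖ (`IsFixedPointMap.norm_sub_le`) carries continuity and Lipschitz continuity over from f to
-- φ. If f is strictly differentiable, the contraction property forces the partial derivative B in
-- the F-direction to satisfy ‖B‖ ≤ θ; hence 1 - B is invertible by the Neumann series, and φ' is (1
-- - B)⁻¹ composed with the partial derivative of f in the E-direction.
--
-- For higher orders, φ^{[1]}(p,q,t) is itself a fixed point, namely of y ↦
-- f^{[1]}((p,φ(p)),(q,y),t), a family of contractions with the same θ (`contr_quotFamily`). For t ≠
-- 0 the fixed point is the difference quotient of φ; for t = 0 Banach's theorem supplies it, and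
-- continuous dependence on parameters shows that the two cases fit together (`exists_quot`). The
-- new family is f^{[1]} composed with a map built from φ, so induction on the order and the chain
-- rule finish the proof (`IsFixedPointMap.isDiffAux`). The slices {y : φ(p) + t y ∈ U, ...} of the
-- new family vary with the parameter; therefore the induction runs over relatively open D ⊆ Q × F,
-- not over products.
--
-- Openness of Q is Banach's theorem on a small closed ball that nearby maps send to itself.

universe v' w'

open Filter Topology Set

/-! ### Gauges and their comparison. -/

section Gauges

variable {𝕜 : Type*} [NontriviallyNormedField 𝕜]
  {E : Type*} [AddCommGroup E] [Module 𝕜 E] [TopologicalSpace E]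
  {F : Type*} [AddCommGroup F] [Module 𝕜 F] [TopologicalSpace F]

theorem IsGauge.map_zero {γ : E → ℝ} (h : IsGauge 𝕜 γ) : γ 0 = 0 := by
  simpa using h.smul 0 0

theorem IsGauge.comp_clm {γ : F → ℝ} (h : IsGauge 𝕜 γ) (L : E →L[𝕜] F) :
    IsGauge 𝕜 (fun x => γ (L x)) where
  nonneg x := h.nonneg _
  smul t x := by rw [map_smul, h.smul]
  usc := h.usc.comp L.continuous

theorem IsGauge.sup {γ η : E → ℝ} (h : IsGauge 𝕜 γ) (h' : IsGauge 𝕜 η) :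
    IsGauge 𝕜 (fun x => max (γ x) (η x)) where
  nonneg x := (h.nonneg x).trans (le_max_left _ _)
  smul t x := by rw [h.smul, h'.smul, mul_max_of_nonneg _ _ (norm_nonneg t)]
  usc := h.usc.sup h'.usc

theorem IsGauge.const_mul {γ : E → ℝ} (h : IsGauge 𝕜 γ) {C : ℝ} (hC : 0 < C) :
    IsGauge 𝕜 (fun x => C * γ x) where
  nonneg x := mul_nonneg hC.le (h.nonneg x)
  smul t x := by rw [h.smul]; ring
  usc := by
    intro x r hr
    have : γ x < r / C := by rwa [lt_div_iff₀' hC]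
    filter_upwards [h.usc x _ this] with y hy
    rwa [lt_div_iff₀' hC] at hy

theorem isGauge_norm {F : Type*} [NormedAddCommGroup F] [NormedSpace 𝕜 F] :
    IsGauge 𝕜 (fun x : F => ‖x‖) :=
  ⟨norm_nonneg, norm_smul, continuous_norm.upperSemicontinuous⟩

/-- By upper semicontinuity γ < 1 on a ball, and every nonzero vector can be scaled into a shell of
that ball. Estimates with values in the Banach space thus need only be checked for the norm. -/
theorem IsGauge.le_const_mul_norm {F : Type*} [NormedAddCommGroup F] [NormedSpace 𝕜 F]
    {γ : F → ℝ} (h : IsGauge 𝕜 γ) : ∃ C : ℝ, 0 < C ∧ ∀ x, γ x ≤ C * ‖x‖ := by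
  have h0 : {x : F | γ x < 1} ∈ 𝓝 (0 : F) := h.usc 0 1 (by simp [h.map_zero])
  obtain ⟨r, hr, hrb⟩ := Metric.mem_nhds_iff.1 h0
  obtain ⟨c, hc⟩ := NormedField.exists_one_lt_norm 𝕜
  refine ⟨r⁻¹ * ‖c‖, by positivity, fun x => ?_⟩
  by_cases hx : x = 0
  · simp [hx, h.map_zero]
  obtain ⟨d, hd, hdr, -, hdx⟩ := rescale_to_shell hc hr hx
  have h1 : γ (d • x) < 1 := hrb (by simpa using hdr)
  rw [h.smul] at h1
  have hd' : 0 < ‖d‖ := norm_pos_iff.2 hd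
  calc γ x = ‖d‖⁻¹ * (‖d‖ * γ x) := by field_simp
    _ ≤ ‖d‖⁻¹ * 1 := by gcongr
    _ ≤ _ := by simpa using hdx

theorem IsGauge.eventually_sub_lt [IsTopologicalAddGroup E] {η : E → ℝ} (h : IsGauge 𝕜 η)
    (x₀ : E) {δ : ℝ} (hδ : 0 < δ) : ∀ᶠ x in 𝓝 x₀, η (x - x₀) < δ := by
  have h0 : ∀ᶠ x in 𝓝 (0 : E), η x < δ := h.usc 0 δ (by simpa [h.map_zero] using hδ)
  have : Tendsto (fun x => x - x₀) (𝓝 x₀) (𝓝 0) := by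
    have : Continuous fun x : E => x - x₀ := by fun_prop
    simpa using this.tendsto x₀
  exact this.eventually h0

/-- The Minkowski functional of a balanced open neighbourhood inside `W` is a gauge. -/
theorem exists_isGauge_of_mem_nhds [ContinuousSMul 𝕜 E] {W : Set E} (hW : W ∈ 𝓝 (0 : E)) :
    ∃ η : E → ℝ, IsGauge 𝕜 η ∧ ∀ x r, η x < r →
      ∃ s : 𝕜, s ≠ 0 ∧ ‖s‖ < r ∧ ∀ t : 𝕜, ‖s‖ ≤ ‖t‖ → t⁻¹ • x ∈ W := by
  obtain ⟨V', ⟨hV'0, hV'b⟩, hV'W⟩ := (nhds_basis_balanced 𝕜 E).mem_iff.1 hW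
  set V := interior V' with hV
  have hV0 : (0 : E) ∈ V := mem_interior_iff_mem_nhds.2 hV'0
  have hVb : Balanced 𝕜 V := hV'b.interior hV0
  have hVo : IsOpen V := isOpen_interior
  have hVW : V ⊆ W := interior_subset.trans hV'W
  let A : E → Set ℝ := fun x => {r | ∃ t : 𝕜, t ≠ 0 ∧ t⁻¹ • x ∈ V ∧ ‖t‖ = r}
  have hbdd : ∀ x, BddBelow (A x) := fun x => ⟨0, by rintro r ⟨t, -, -, rfl⟩; positivity⟩
  have hne : ∀ x, (A x).Nonempty := by
    intro x
    have h1 : Tendsto (fun s : 𝕜 => s • x) (𝓝[≠] 0) (𝓝 0) := by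
      have : Continuous fun s : 𝕜 => s • x := by fun_prop
      have := this.tendsto 0
      rw [zero_smul] at this
      exact this.mono_left nhdsWithin_le_nhds
    obtain ⟨s, hs, hs0⟩ := ((h1.eventually (hVo.mem_nhds hV0)).and self_mem_nhdsWithin).exists
    exact ⟨_, s⁻¹, inv_ne_zero hs0, by rw [inv_inv]; exact hs, rfl⟩
  have hlt : ∀ x r, sInf (A x) < r ↔ ∃ t : 𝕜, t ≠ 0 ∧ ‖t‖ < r ∧ t⁻¹ • x ∈ V := by
    intro x r
    rw [csInf_lt_iff (hbdd x) (hne x)]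
    constructor
    · rintro ⟨_, ⟨t, ht, htV, rfl⟩, hr⟩
      exact ⟨t, ht, hr, htV⟩
    · rintro ⟨t, ht, hr, htV⟩
      exact ⟨_, ⟨t, ht, htV, rfl⟩, hr⟩
  have hnn : ∀ x, 0 ≤ sInf (A x) := fun x =>
    le_csInf (hne x) (by rintro r ⟨t, -, -, rfl⟩; positivity)
  refine ⟨fun x => sInf (A x), ⟨hnn, ?_, ?_⟩, ?_⟩
  · intro s x
    by_cases hs : s = 0
    · subst hs
      simp only [zero_smul, norm_zero, zero_mul]
      refine le_antisymm (le_of_forall_gt fun r hr => (hlt _ _).2 ?_) (hnn _)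
      obtain ⟨t, ht0, ht⟩ := NormedField.exists_norm_lt 𝕜 hr
      exact ⟨t, norm_pos_iff.1 ht0, ht, by simpa using hV0⟩
    · have hs' : 0 < ‖s‖ := norm_pos_iff.2 hs
      refine eq_of_forall_gt_iff fun r => ?_
      rw [← lt_div_iff₀' hs', hlt, hlt]
      constructor
      · rintro ⟨t, ht, htr, htV⟩
        refine ⟨s⁻¹ * t, mul_ne_zero (inv_ne_zero hs) ht, ?_, ?_⟩
        · rw [norm_mul, norm_inv, lt_div_iff₀' hs']
          simpa [hs'.ne'] using htr
        · rwa [mul_inv, inv_inv, mul_comm, mul_smul]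
      · rintro ⟨t, ht, htr, htV⟩
        refine ⟨s * t, mul_ne_zero hs ht, ?_, ?_⟩
        · rwa [norm_mul, ← lt_div_iff₀' hs']
        · rw [smul_smul, mul_inv, mul_right_comm, inv_mul_cancel₀ hs, one_mul]
          exact htV
  · intro x r hr
    obtain ⟨t, ht, htr, htV⟩ := (hlt x r).1 hr
    have : ∀ᶠ y in 𝓝 x, t⁻¹ • y ∈ V :=
      (continuous_const_smul t⁻¹).continuousAt.eventually (hVo.mem_nhds htV)
    filter_upwards [this] with y hy
    exact (hlt y r).2 ⟨t, ht, htr, hy⟩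
  · intro x r hr
    obtain ⟨s, hs, hsr, hsV⟩ := (hlt x r).1 hr
    -- Balancedness makes every larger scalar work as well, so that two gauges can later share one
    -- scalar.
    refine ⟨s, hs, hsr, fun t ht => hVW ?_⟩
    have : t⁻¹ • x = (t⁻¹ * s) • (s⁻¹ • x) := by
      rw [smul_smul, mul_assoc, mul_inv_cancel₀ hs, mul_one]
    rw [this]
    refine hVb.smul_mem ?_ hsV
    have hs' : 0 < ‖s‖ := norm_pos_iff.2 hs
    rw [norm_mul, norm_inv, inv_mul_le_iff₀ (hs'.trans_le ht), mul_one]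
    exact ht

theorem exists_isGauge_ball_subset [ContinuousSMul 𝕜 E] [IsTopologicalAddGroup E] {x₀ : E}
    {W : Set E} (hW : W ∈ 𝓝 x₀) :
    ∃ η : E → ℝ, IsGauge 𝕜 η ∧ ∀ x, η (x - x₀) < 1 → x ∈ W := by
  have h0 : {y | y + x₀ ∈ W} ∈ 𝓝 (0 : E) := by
    have : Continuous fun y : E => y + x₀ := by fun_prop
    exact this.continuousAt.preimage_mem_nhds (by simpa using hW)
  obtain ⟨η, hη, h⟩ := exists_isGauge_of_mem_nhds (𝕜 := 𝕜) h0
  refine ⟨η, hη, fun x hx => ?_⟩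
  obtain ⟨s, -, hs1, hs⟩ := h _ _ hx
  simpa using hs 1 (by simpa using hs1.le)

theorem IsGauge.exists_prod_le [ContinuousSMul 𝕜 E] [ContinuousSMul 𝕜 F] {γ : E × F → ℝ}
    (hγ : IsGauge 𝕜 γ) : ∃ γ₁ : E → ℝ, IsGauge 𝕜 γ₁ ∧ ∃ γ₂ : F → ℝ, IsGauge 𝕜 γ₂ ∧
      ∀ x y, γ (x, y) ≤ max (γ₁ x) (γ₂ y) := by
  have h0 : {z : E × F | γ z < 1} ∈ 𝓝 ((0 : E), (0 : F)) :=
    hγ.usc 0 1 (by simp [hγ.map_zero])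
  obtain ⟨V₁, hV₁, V₂, hV₂, hV⟩ := mem_nhds_prod_iff.1 h0
  obtain ⟨γ₁, hγ₁, h₁⟩ := exists_isGauge_of_mem_nhds (𝕜 := 𝕜) hV₁
  obtain ⟨γ₂, hγ₂, h₂⟩ := exists_isGauge_of_mem_nhds (𝕜 := 𝕜) hV₂
  refine ⟨γ₁, hγ₁, γ₂, hγ₂, fun x y => le_of_forall_gt fun r hr => ?_⟩
  obtain ⟨s, hs, hsr, hsV⟩ := h₁ x r ((le_max_left _ _).trans_lt hr)
  obtain ⟨s', hs', hsr', hsV'⟩ := h₂ y r ((le_max_right _ _).trans_lt hr)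
  obtain ⟨t, ht, htr, hst, hst'⟩ : ∃ t : 𝕜, t ≠ 0 ∧ ‖t‖ < r ∧ ‖s‖ ≤ ‖t‖ ∧ ‖s'‖ ≤ ‖t‖ := by
    rcases le_total ‖s‖ ‖s'‖ with h | h
    · exact ⟨s', hs', hsr', h, le_rfl⟩
    · exact ⟨s, hs, hsr, le_rfl, h⟩
  have h1 : γ (t⁻¹ • (x, y)) < 1 := hV ⟨hsV t hst, hsV' t hst'⟩
  rw [hγ.smul, norm_inv, inv_mul_lt_iff₀ (norm_pos_iff.2 ht), mul_one] at h1
  exact h1.trans htr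

/-- A substitute for the triangle inequality, since gauges need not be subadditive: γ composed with
addition is a gauge on E × E, hence dominated by gauges on the factors. -/
theorem IsGauge.exists_add_le [ContinuousSMul 𝕜 E] [IsTopologicalAddGroup E] {γ : E → ℝ}
    (hγ : IsGauge 𝕜 γ) :
    ∃ η : E → ℝ, IsGauge 𝕜 η ∧ ∀ x y, γ (x + y) ≤ max (η x) (η y) := by
  obtain ⟨γ₁, h₁, γ₂, h₂, h⟩ := (hγ.comp_clm
    (ContinuousLinearMap.fst 𝕜 E E + ContinuousLinearMap.snd 𝕜 E E)).exists_prod_le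
  refine ⟨_, h₁.sup h₂, fun x y => (h x y).trans ?_⟩
  exact max_le_max (le_max_left _ _) (le_max_right _ _)

end Gauges

/-! ### Lipschitz and strictly differentiable maps: composition, pairing, linear maps. -/

section Level

variable {𝕜 : Type*} [NontriviallyNormedField 𝕜]
  {E : Type*} [AddCommGroup E] [Module 𝕜 E] [TopologicalSpace E]
  {F : Type*} [AddCommGroup F] [Module 𝕜 F] [TopologicalSpace F]
  {G : Type*} [AddCommGroup G] [Module 𝕜 G] [TopologicalSpace G]

theorem lipschitzContOn_iff_eventually [IsTopologicalAddGroup E] [ContinuousSMul 𝕜 E]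
    {U : Set E} {f : E → F} :
    LipschitzContOn 𝕜 U f ↔ ∀ x₀ ∈ U, ∀ γ : F → ℝ, IsGauge 𝕜 γ → ∃ η : E → ℝ, IsGauge 𝕜 η ∧
      ∀ᶠ z in 𝓝[U] x₀ ×ˢ 𝓝[U] x₀, γ (f z.2 - f z.1) ≤ η (z.2 - z.1) := by
  refine forall₄_congr fun x₀ _ γ _ => ⟨?_, ?_⟩
  · rintro ⟨η, hη, δ, hδ, h⟩
    refine ⟨η, hη, ?_⟩
    have hU : ∀ᶠ x in 𝓝[U] x₀, x ∈ U ∧ η (x - x₀) < δ :=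
      eventually_mem_nhdsWithin.and (nhdsWithin_le_nhds (hη.eventually_sub_lt x₀ hδ))
    filter_upwards [hU.prod_mk hU] with z hz
    exact h _ hz.1.1 _ hz.2.1 hz.1.2 hz.2.2
  · rintro ⟨η, hη, h⟩
    obtain ⟨V, hV, hVh⟩ := mem_prod_same_iff.1 h
    obtain ⟨O, hO, hOV⟩ := mem_nhdsWithin_iff_exists_mem_nhds_inter.1 hV
    -- One and the same gauge must both localise and bound; `ζ` localises, and the maximum with `η`
    -- does both.
    obtain ⟨ζ, hζ, hζO⟩ := exists_isGauge_ball_subset (𝕜 := 𝕜) hO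
    refine ⟨_, hη.sup hζ, 1, one_pos, fun x hx y hy hx1 hy1 => ?_⟩
    have hxV : x ∈ V := hOV ⟨hζO x ((le_max_right _ _).trans_lt hx1), hx⟩
    have hyV : y ∈ V := hOV ⟨hζO y ((le_max_right _ _).trans_lt hy1), hy⟩
    exact (@hVh (x, y) ⟨hxV, hyV⟩).trans (le_max_left _ _)

theorem LipschitzContOn.comp [IsTopologicalAddGroup E] [ContinuousSMul 𝕜 E]
    [IsTopologicalAddGroup F] [ContinuousSMul 𝕜 F] {U : Set E} {V : Set F} {f : E → F} {g : F → G}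
    (hg : LipschitzContOn 𝕜 V g) (hf : LipschitzContOn 𝕜 U f) (hfc : ContinuousOn f U)
    (hUV : MapsTo f U V) : LipschitzContOn 𝕜 U (fun x => g (f x)) := by
  rw [lipschitzContOn_iff_eventually] at *
  intro x₀ hx₀ γ hγ
  obtain ⟨η, hη, h⟩ := hg _ (hUV hx₀) γ hγ
  obtain ⟨ζ, hζ, h'⟩ := hf _ hx₀ η hη
  refine ⟨ζ, hζ, ?_⟩
  have ht : Tendsto f (𝓝[U] x₀) (𝓝[V] f x₀) := (hfc x₀ hx₀).tendsto_nhdsWithin hUV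
  filter_upwards [(ht.prodMap ht).eventually h, h'] with z hz hz'
  exact hz.trans hz'

theorem LipschitzContOn.prodMk [IsTopologicalAddGroup E] [ContinuousSMul 𝕜 E]
    [ContinuousSMul 𝕜 F] [ContinuousSMul 𝕜 G] {U : Set E} {f : E → F} {g : E → G}
    (hf : LipschitzContOn 𝕜 U f) (hg : LipschitzContOn 𝕜 U g) :
    LipschitzContOn 𝕜 U (fun x => (f x, g x)) := by
  rw [lipschitzContOn_iff_eventually] at *
  intro x₀ hx₀ γ hγ
  obtain ⟨γ₁, h₁, γ₂, h₂, h⟩ := hγ.exists_prod_le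
  obtain ⟨η₁, hη₁, h1⟩ := hf x₀ hx₀ γ₁ h₁
  obtain ⟨η₂, hη₂, h2⟩ := hg x₀ hx₀ γ₂ h₂
  refine ⟨_, hη₁.sup hη₂, ?_⟩
  filter_upwards [h1, h2] with z hz1 hz2
  exact (h _ _).trans (max_le_max hz1 hz2)

theorem LipschitzContOn.clm (U : Set E) (L : E →L[𝕜] F) : LipschitzContOn 𝕜 U L := by
  intro x₀ _ γ hγ
  exact ⟨_, hγ.comp_clm L, 1, one_pos, fun x _ y _ _ _ => by rw [map_sub]⟩

theorem StrictDiffOn.lipschitzContOn [IsTopologicalAddGroup F] [ContinuousSMul 𝕜 F]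
    {U : Set E} {f : E → F} (hf : StrictDiffOn 𝕜 U f) : LipschitzContOn 𝕜 U f := by
  intro x₀ hx₀ γ hγ
  obtain ⟨f', hf'⟩ := hf x₀ hx₀
  obtain ⟨γ₂, hγ₂, h2⟩ := hγ.exists_add_le
  obtain ⟨η, hη, h⟩ := hf' γ₂ hγ₂
  obtain ⟨δ, hδ, h⟩ := h 1 one_pos
  refine ⟨_, hη.sup (hγ₂.comp_clm f'), δ, hδ, fun x hx y hy hx1 hy1 => ?_⟩
  have := h x hx y hy ((le_max_left _ _).trans_lt hy1) ((le_max_left _ _).trans_lt hx1)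
  rw [one_mul] at this
  calc γ (f y - f x) = γ ((f y - f x - f' (y - x)) + f' (y - x)) := by rw [sub_add_cancel]
    _ ≤ _ := h2 _ _
    _ ≤ _ := max_le_max this le_rfl

theorem StrictDiffOn.comp [IsTopologicalAddGroup F] [ContinuousSMul 𝕜 F]
    [IsTopologicalAddGroup G] [ContinuousSMul 𝕜 G] {U : Set E} {V : Set F} {f : E → F} {g : F → G}
    (hg : StrictDiffOn 𝕜 V g) (hf : StrictDiffOn 𝕜 U f) (hUV : MapsTo f U V) :
    StrictDiffOn 𝕜 U (fun x => g (f x)) := by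
  intro x hx
  obtain ⟨f', hf'⟩ := hf x hx
  obtain ⟨g', hg'⟩ := hg _ (hUV hx)
  refine ⟨g'.comp f', fun γ hγ => ?_⟩
  obtain ⟨γ₂, hγ₂, h2⟩ := hγ.exists_add_le
  obtain ⟨η, hη, hgη⟩ := hg' γ₂ hγ₂
  obtain ⟨ζ₁, hζ₁, hfζ⟩ := hf' _ (hγ₂.comp_clm g')
  obtain ⟨ζ₂, hζ₂, δ₂, hδ₂, hL⟩ := hf.lipschitzContOn x hx η hη
  refine ⟨_, hζ₁.sup hζ₂, fun ε hε => ?_⟩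
  obtain ⟨δg, hδg, hgd⟩ := hgη ε hε
  obtain ⟨δf, hδf, hfd⟩ := hfζ ε hε
  refine ⟨min δ₂ (min δg δf), by positivity, fun y hy z hz hz1 hy1 => ?_⟩
  simp only [lt_min_iff, max_lt_iff] at hz1 hy1
  have hx0 : ζ₂ (x - x) < δ₂ := by rwa [sub_self, hζ₂.map_zero]
  have hzg : η (f z - f x) < δg := (hL x hx z hz hx0 hz1.1.2).trans_lt hz1.2.1.2
  have hyg : η (f y - f x) < δg := (hL x hx y hy hx0 hy1.1.2).trans_lt hy1.2.1.2
  have e1 := hgd _ (hUV hy) _ (hUV hz) hzg hyg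
  have e2 := hfd y hy z hz hz1.2.2.1 hy1.2.2.1
  have e3 := hL y hy z hz hy1.1.2 hz1.1.2
  calc γ (g (f z) - g (f y) - (g'.comp f') (z - y))
      = γ ((g (f z) - g (f y) - g' (f z - f y)) + g' (f z - f y - f' (z - y))) := by
        congr 1
        rw [map_sub g' (f z - f y), ContinuousLinearMap.comp_apply]
        abel
    _ ≤ _ := h2 _ _
    _ ≤ max (ε * ζ₂ (z - y)) (ε * ζ₁ (z - y)) :=
        max_le_max (e1.trans (mul_le_mul_of_nonneg_left e3 hε.le)) e2
    _ = _ := by rw [← mul_max_of_nonneg _ _ hε.le, max_comm]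

theorem StrictDiffOn.prodMk [ContinuousSMul 𝕜 F] [ContinuousSMul 𝕜 G] {U : Set E} {f : E → F}
    {g : E → G} (hf : StrictDiffOn 𝕜 U f) (hg : StrictDiffOn 𝕜 U g) :
    StrictDiffOn 𝕜 U (fun x => (f x, g x)) := by
  intro x hx
  obtain ⟨f', hf'⟩ := hf x hx
  obtain ⟨g', hg'⟩ := hg x hx
  refine ⟨f'.prod g', fun γ hγ => ?_⟩
  obtain ⟨γ₁, h₁, γ₂, h₂, h⟩ := hγ.exists_prod_le
  obtain ⟨η₁, hη₁, h1⟩ := hf' γ₁ h₁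
  obtain ⟨η₂, hη₂, h2⟩ := hg' γ₂ h₂
  refine ⟨_, hη₁.sup hη₂, fun ε hε => ?_⟩
  obtain ⟨δ₁, hδ₁, h1⟩ := h1 ε hε
  obtain ⟨δ₂, hδ₂, h2⟩ := h2 ε hε
  refine ⟨min δ₁ δ₂, by positivity, fun y hy z hz hz1 hy1 => ?_⟩
  simp only [lt_min_iff, max_lt_iff] at hz1 hy1
  rw [mul_max_of_nonneg _ _ hε.le]
  exact (h _ _).trans (max_le_max (h1 y hy z hz hz1.1.1 hy1.1.1) (h2 y hy z hz hz1.2.2 hy1.2.2))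

theorem StrictDiffOn.clm (U : Set E) (L : E →L[𝕜] F) : StrictDiffOn 𝕜 U L := by
  intro x _
  refine ⟨L, fun γ hγ => ⟨_, hγ.comp_clm L, fun ε hε => ⟨1, one_pos, fun y _ z _ _ _ => ?_⟩⟩⟩
  rw [map_sub, sub_self, hγ.map_zero]
  exact mul_nonneg hε.le (hγ.nonneg _)

theorem StrictDiffOn.congr {U : Set E} {f g : E → F} (hf : StrictDiffOn 𝕜 U f)
    (h : EqOn g f U) : StrictDiffOn 𝕜 U g := by
  intro x hx
  obtain ⟨f', hf'⟩ := hf x hx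
  refine ⟨f', fun γ hγ => ?_⟩
  obtain ⟨η, hη, H⟩ := hf' γ hγ
  refine ⟨η, hη, fun ε hε => ?_⟩
  obtain ⟨δ, hδ, H⟩ := H ε hε
  refine ⟨δ, hδ, fun y hy z hz => ?_⟩
  rw [h hy, h hz]
  exact H y hy z hz

theorem LipschitzContOn.congr {U : Set E} {f g : E → F} (hf : LipschitzContOn 𝕜 U f)
    (h : EqOn g f U) : LipschitzContOn 𝕜 U g := by
  intro x hx γ hγ
  obtain ⟨η, hη, δ, hδ, H⟩ := hf x hx γ hγ
  refine ⟨η, hη, δ, hδ, fun y hy z hz => ?_⟩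
  rw [h hy, h hz]
  exact H y hy z hz

theorem LevelCond.congr {c : DiffKind} {r : ℕ} {U : Set E} {f g : E → F}
    (hf : LevelCond 𝕜 c r U f) (h : EqOn g f U) : LevelCond 𝕜 c r U g := by
  refine ⟨hf.1.congr h, ?_⟩
  match c, hf with
  | .C, _ => trivial
  | .SC, hf => exact fun hr => (hf.2 hr).congr h
  | .LC, hf => exact LipschitzContOn.congr hf.2 h

theorem LevelCond.mono {c : DiffKind} {r s : ℕ} {U : Set E} {f : E → F}
    (hf : LevelCond 𝕜 c r U f) (h : s ≤ r) : LevelCond 𝕜 c s U f := by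
  refine ⟨hf.1, ?_⟩
  match c, hf with
  | .C, _ => trivial
  | .SC, hf => exact fun hr => hf.2 (hr.trans_le h)
  | .LC, hf => exact hf.2

theorem LevelCond.comp [IsTopologicalAddGroup E] [ContinuousSMul 𝕜 E]
    [IsTopologicalAddGroup F] [ContinuousSMul 𝕜 F] [IsTopologicalAddGroup G] [ContinuousSMul 𝕜 G]
    {c : DiffKind} {r : ℕ} {U : Set E} {V : Set F} {f : E → F} {g : F → G}
    (hg : LevelCond 𝕜 c r V g) (hf : LevelCond 𝕜 c r U f) (hUV : MapsTo f U V) :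
    LevelCond 𝕜 c r U (fun x => g (f x)) := by
  refine ⟨hg.1.comp hf.1 hUV, ?_⟩
  match c, hf, hg with
  | .C, _, _ => trivial
  | .SC, hf, hg => exact fun hr => (hg.2 hr).comp (hf.2 hr) hUV
  | .LC, hf, hg => exact LipschitzContOn.comp hg.2 hf.2 hf.1 hUV

theorem LevelCond.prodMk [IsTopologicalAddGroup E] [ContinuousSMul 𝕜 E]
    [ContinuousSMul 𝕜 F] [ContinuousSMul 𝕜 G]
    {c : DiffKind} {r : ℕ} {U : Set E} {f : E → F} {g : E → G}
    (hf : LevelCond 𝕜 c r U f) (hg : LevelCond 𝕜 c r U g) :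
    LevelCond 𝕜 c r U (fun x => (f x, g x)) := by
  refine ⟨hf.1.prodMk hg.1, ?_⟩
  match c, hf, hg with
  | .C, _, _ => trivial
  | .SC, hf, hg => exact fun hr => (hf.2 hr).prodMk (hg.2 hr)
  | .LC, hf, hg => exact LipschitzContOn.prodMk hf.2 hg.2

theorem LevelCond.clm (c : DiffKind) (r : ℕ) (U : Set E) (L : E →L[𝕜] F) :
    LevelCond 𝕜 c r U L := by
  refine ⟨L.continuous.continuousOn, ?_⟩
  match c with
  | .C => trivial
  | .SC => exact fun _ => StrictDiffOn.clm U L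
  | .LC => exact LipschitzContOn.clm U L

end Level

/-! ### Calculus of extended difference quotients. -/

section DqDomain

variable {𝕜 : Type*} [NontriviallyNormedField 𝕜]
  {E : Type*} [AddCommGroup E] [Module 𝕜 E]
  {F : Type*} [AddCommGroup F] [Module 𝕜 F]
  {G : Type*} [AddCommGroup G] [Module 𝕜 G]

theorem dqDomain.map_mem {U : Set E} {V : Set F} {L : E →ₗ[𝕜] F} (h : MapsTo L U V)
    {z : E × E × 𝕜} (hz : z ∈ dqDomain 𝕜 U) : (L z.1, L z.2.1, z.2.2) ∈ dqDomain 𝕜 V := by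
  refine ⟨h hz.1, ?_⟩
  have := h hz.2
  rwa [map_add, map_smul] at this

variable [TopologicalSpace E] [TopologicalSpace F] [TopologicalSpace G]

theorem IsExtDiffQuot.clm_comp_clm {E' : Type*} [AddCommGroup E'] [Module 𝕜 E']
    [TopologicalSpace E'] {U : Set E} {f : E → F} {f₁ : E × E × 𝕜 → F}
    (h : IsExtDiffQuot 𝕜 U f f₁) (L : E' →L[𝕜] E) (A : F →L[𝕜] G) {U' : Set E'} {f' : E' → G}
    (hL : MapsTo L U' U) (hf : ∀ x ∈ U', f' x = A (f (L x))) :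
    IsExtDiffQuot 𝕜 U' f' (fun z => A (f₁ (L z.1, L z.2.1, z.2.2))) where
  cont := by
    refine A.continuous.comp_continuousOn (h.cont.comp (by fun_prop) fun z hz => ?_)
    exact dqDomain.map_mem (L := L.toLinearMap) hL hz
  eq x y t ht hz := by
    have := dqDomain.map_mem (L := L.toLinearMap) hL hz
    simp only [ContinuousLinearMap.coe_coe] at this
    rw [h.eq _ _ _ ht this, hf _ hz.1, hf _ hz.2, map_smul, map_sub, map_add, map_smul]

theorem IsExtDiffQuot.prodMk {U : Set E} {f : E → F} {f₁ : E × E × 𝕜 → F} {g : E → G}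
    {g₁ : E × E × 𝕜 → G} (hf : IsExtDiffQuot 𝕜 U f f₁) (hg : IsExtDiffQuot 𝕜 U g g₁) :
    IsExtDiffQuot 𝕜 U (fun x => (f x, g x)) (fun z => (f₁ z, g₁ z)) where
  cont := hf.cont.prodMk hg.cont
  eq x y t ht hz := by rw [hf.eq _ _ _ ht hz, hg.eq _ _ _ ht hz]; rfl

/-- This form of the defining equation also holds for t = 0, so the chain rule below needs no case
distinction. -/
theorem IsExtDiffQuot.add_smul_eq {U : Set E} {f : E → F} {f₁ : E × E × 𝕜 → F}
    (h : IsExtDiffQuot 𝕜 U f f₁) {z : E × E × 𝕜} (hz : z ∈ dqDomain 𝕜 U) :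
    f z.1 + z.2.2 • f₁ z = f (z.1 + z.2.2 • z.2.1) := by
  obtain ⟨x, y, t⟩ := z
  by_cases ht : t = 0
  · simp [ht]
  · rw [h.eq x y t ht hz, smul_smul, mul_inv_cancel₀ ht, one_smul, add_sub_cancel]

theorem IsExtDiffQuot.mapsTo {U : Set E} {V : Set F} {f : E → F} {f₁ : E × E × 𝕜 → F}
    (h : IsExtDiffQuot 𝕜 U f f₁) (hUV : MapsTo f U V) :
    MapsTo (fun z : E × E × 𝕜 => (f z.1, f₁ z, z.2.2)) (dqDomain 𝕜 U) (dqDomain 𝕜 V) := by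
  intro z hz
  refine ⟨hUV hz.1, ?_⟩
  simp only [h.add_smul_eq hz]
  exact hUV hz.2

theorem IsExtDiffQuot.comp {U : Set E} {V : Set F} {f : E → F} {f₁ : E × E × 𝕜 → F} {g : F → G}
    {g₁ : F × F × 𝕜 → G} (hg : IsExtDiffQuot 𝕜 V g g₁) (hf : IsExtDiffQuot 𝕜 U f f₁)
    (hfc : ContinuousOn f U) (hUV : MapsTo f U V) :
    IsExtDiffQuot 𝕜 U (fun x => g (f x)) (fun z => g₁ (f z.1, f₁ z, z.2.2)) where
  cont := by
    refine hg.cont.comp (ContinuousOn.prodMk ?_ (hf.cont.prodMk (by fun_prop))) (hf.mapsTo hUV)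
    exact hfc.comp continuousOn_fst fun z hz => hz.1
  eq x y t ht hz := by
    rw [hg.eq _ _ _ ht (hf.mapsTo hUV hz), hf.add_smul_eq hz]

end DqDomain

/-! ### Composition with continuous linear maps on both sides, across universes. -/

section Transport

variable {𝕜 : Type u} [NontriviallyNormedField 𝕜]
  {F : Type w} [AddCommGroup F] [Module 𝕜 F] [TopologicalSpace F] [IsTopologicalAddGroup F]
  [ContinuousSMul 𝕜 F]
  {F' : Type w'} [AddCommGroup F'] [Module 𝕜 F'] [TopologicalSpace F'] [IsTopologicalAddGroup F']
  [ContinuousSMul 𝕜 F']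

theorem LevelCond.clm_comp_clm {c : DiffKind} {r : ℕ} {E : Type v}
    [AddCommGroup E] [Module 𝕜 E] [TopologicalSpace E] [IsTopologicalAddGroup E]
    [ContinuousSMul 𝕜 E] {E' : Type v'} [AddCommGroup E'] [Module 𝕜 E']
    [TopologicalSpace E'] [IsTopologicalAddGroup E'] [ContinuousSMul 𝕜 E'] {U : Set E} {f : E → F}
    (h : LevelCond 𝕜 c r U f) (L : E' →L[𝕜] E) (A : F →L[𝕜] F') {U' : Set E'} {f' : E' → F'}
    (hL : MapsTo L U' U) (hf : ∀ x ∈ U', f' x = A (f (L x))) :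
    LevelCond 𝕜 c r U' f' :=
  LevelCond.congr ((LevelCond.clm c r univ A).comp (h.comp (LevelCond.clm c r U' L) hL)
    (mapsTo_univ _ _)) hf

/-- Since (A ∘ f ∘ L)^{[1]} = A ∘ f^{[1]} ∘ (L × L × id), the induction needs no general chain rule
and leaves the universes of the new spaces free. -/
theorem IsDiffAux.clm_comp_clm {c : DiffKind} {k : ℕ} {E : Type (max u v)}
    [AddCommGroup E] [Module 𝕜 E] [TopologicalSpace E] [IsTopologicalAddGroup E]
    [ContinuousSMul 𝕜 E] {E' : Type (max u v')} [AddCommGroup E'] [Module 𝕜 E']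
    [TopologicalSpace E'] [IsTopologicalAddGroup E'] [ContinuousSMul 𝕜 E'] {U : Set E} {f : E → F}
    (h : IsDiffAux.{u, v, w} 𝕜 c k U f) (L : E' →L[𝕜] E) (A : F →L[𝕜] F') {U' : Set E'}
    {f' : E' → F'} (hL : MapsTo L U' U) (hf : ∀ x ∈ U', f' x = A (f (L x))) :
    IsDiffAux.{u, v', w'} 𝕜 c k U' f' := by
  induction k generalizing E E' with
  | zero => exact LevelCond.clm_comp_clm h L A hL hf
  | succ k ih =>
    obtain ⟨h0, f₁, hf₁, h1⟩ := h
    refine ⟨h0.clm_comp_clm L A hL hf, _, hf₁.clm_comp_clm L A hL hf, ?_⟩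
    exact ih h1 (L.prodMap (L.prodMap (ContinuousLinearMap.id 𝕜 𝕜)))
      (fun z hz => dqDomain.map_mem (L := L.toLinearMap) hL hz) fun x _ => rfl

/-- Comparison of the two recursions, across universes. -/
theorem IsDiffNat.isDiffAux {c : DiffKind} {k : ℕ} {E : Type v}
    [AddCommGroup E] [Module 𝕜 E] [TopologicalSpace E] [IsTopologicalAddGroup E]
    [ContinuousSMul 𝕜 E] {E' : Type (max u v')} [AddCommGroup E'] [Module 𝕜 E']
    [TopologicalSpace E'] [IsTopologicalAddGroup E'] [ContinuousSMul 𝕜 E'] {U : Set E} {f : E → F}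
    (h : IsDiffNat 𝕜 c k U f) (L : E' →L[𝕜] E) (A : F →L[𝕜] F') {U' : Set E'}
    {f' : E' → F'} (hL : MapsTo L U' U) (hf : ∀ x ∈ U', f' x = A (f (L x))) :
    IsDiffAux.{u, v', w'} 𝕜 c k U' f' := by
  cases k with
  | zero => exact LevelCond.clm_comp_clm h L A hL hf
  | succ k =>
    obtain ⟨h0, f₁, hf₁, h1⟩ := h
    refine ⟨h0.clm_comp_clm L A hL hf, _, hf₁.clm_comp_clm L A hL hf, ?_⟩
    exact h1.clm_comp_clm (L.prodMap (L.prodMap (ContinuousLinearMap.id 𝕜 𝕜))) A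
      (fun z hz => dqDomain.map_mem (L := L.toLinearMap) hL hz) fun x _ => rfl

theorem IsDiffAux.isDiffNat {c : DiffKind} {k : ℕ} {E : Type (max u v)}
    [AddCommGroup E] [Module 𝕜 E] [TopologicalSpace E] [IsTopologicalAddGroup E]
    [ContinuousSMul 𝕜 E] {E' : Type v'} [AddCommGroup E'] [Module 𝕜 E']
    [TopologicalSpace E'] [IsTopologicalAddGroup E'] [ContinuousSMul 𝕜 E'] {U : Set E} {f : E → F}
    (h : IsDiffAux.{u, v, w} 𝕜 c k U f) (L : E' →L[𝕜] E) (A : F →L[𝕜] F') {U' : Set E'}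
    {f' : E' → F'} (hL : MapsTo L U' U) (hf : ∀ x ∈ U', f' x = A (f (L x))) :
    IsDiffNat 𝕜 c k U' f' := by
  cases k with
  | zero => exact LevelCond.clm_comp_clm h L A hL hf
  | succ k =>
    obtain ⟨h0, f₁, hf₁, h1⟩ := h
    refine ⟨h0.clm_comp_clm L A hL hf, _, hf₁.clm_comp_clm L A hL hf, ?_⟩
    exact h1.clm_comp_clm (L.prodMap (L.prodMap (ContinuousLinearMap.id 𝕜 𝕜))) A
      (fun z hz => dqDomain.map_mem (L := L.toLinearMap) hL hz) fun x _ => rfl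

end Transport

/-! ### The chain rule for maps of order k. -/

section ChainRule

variable {𝕜 : Type u} [NontriviallyNormedField 𝕜]
  {E : Type (max u v)} [AddCommGroup E] [Module 𝕜 E] [TopologicalSpace E]
  {F : Type (max u v)} [AddCommGroup F] [Module 𝕜 F] [TopologicalSpace F]
  {G : Type (max u v)} [AddCommGroup G] [Module 𝕜 G] [TopologicalSpace G]

theorem IsDiffAux.of_succ {c : DiffKind} {k : ℕ} {U : Set E} {f : E → F}
    (h : IsDiffAux.{u, v, max u v} 𝕜 c (k + 1) U f) : IsDiffAux.{u, v, max u v} 𝕜 c k U f := by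
  induction k generalizing E with
  | zero => exact h.1.mono (Nat.zero_le _)
  | succ k ih =>
    obtain ⟨h0, f₁, hf₁, h1⟩ := h
    exact ⟨h0.mono (Nat.le_succ _), f₁, hf₁, ih h1⟩

variable [ContinuousSMul 𝕜 F] [ContinuousSMul 𝕜 G]

theorem IsDiffAux.prodMk {F : Type w} [AddCommGroup F] [Module 𝕜 F] [TopologicalSpace F]
    [ContinuousSMul 𝕜 F] {G : Type w'} [AddCommGroup G] [Module 𝕜 G] [TopologicalSpace G]
    [ContinuousSMul 𝕜 G] [IsTopologicalAddGroup E] [ContinuousSMul 𝕜 E] {c : DiffKind} {k : ℕ}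
    {U : Set E} {f : E → F} {g : E → G}
    (hf : IsDiffAux.{u, v, w} 𝕜 c k U f) (hg : IsDiffAux.{u, v, w'} 𝕜 c k U g) :
    IsDiffAux.{u, v, max w w'} 𝕜 c k U (fun x => (f x, g x)) := by
  induction k generalizing E with
  | zero => exact LevelCond.prodMk hf hg
  | succ k ih =>
    obtain ⟨hf0, f₁, hf₁, hf1⟩ := hf
    obtain ⟨hg0, g₁, hg₁, hg1⟩ := hg
    exact ⟨hf0.prodMk hg0, _, hf₁.prodMk hg₁, ih hf1 hg1⟩

theorem IsDiffAux.clm {F : Type w} [AddCommGroup F] [Module 𝕜 F] [TopologicalSpace F]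
    [IsTopologicalAddGroup F] [ContinuousSMul 𝕜 F] (c : DiffKind) (k : ℕ) (U : Set E)
    (L : E →L[𝕜] F) : IsDiffAux.{u, v, w} 𝕜 c k U L := by
  induction k generalizing E with
  | zero => exact LevelCond.clm c 0 U L
  | succ k ih =>
    refine ⟨LevelCond.clm c _ U L, L.comp ((ContinuousLinearMap.fst 𝕜 E 𝕜).comp
      (ContinuousLinearMap.snd 𝕜 E (E × 𝕜))), ⟨?_, fun x y t ht _ => ?_⟩, ih _ _⟩
    · exact (ContinuousLinearMap.continuous _).continuousOn
    · simp [smul_smul, inv_mul_cancel₀ ht]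

variable [IsTopologicalAddGroup E] [ContinuousSMul 𝕜 E] [IsTopologicalAddGroup F]
  [IsTopologicalAddGroup G]

theorem IsDiffAux.comp_clm {E' : Type (max u v)} [AddCommGroup E'] [Module 𝕜 E']
    [TopologicalSpace E'] [IsTopologicalAddGroup E'] [ContinuousSMul 𝕜 E'] {c : DiffKind} {k : ℕ}
    {U : Set E} {f : E → F} (h : IsDiffAux.{u, v, max u v} 𝕜 c k U f) (L : E' →L[𝕜] E)
    {U' : Set E'} (hL : MapsTo L U' U) :
    IsDiffAux.{u, v, max u v} 𝕜 c k U' (fun x => f (L x)) :=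
  h.clm_comp_clm L (ContinuousLinearMap.id 𝕜 F) hL fun _ _ => rfl

theorem IsDiffAux.comp {c : DiffKind} {k : ℕ}
    {U : Set E} {V : Set F} {f : E → F} {g : F → G}
    (hg : IsDiffAux.{u, v, max u v} 𝕜 c k V g) (hf : IsDiffAux.{u, v, max u v} 𝕜 c k U f)
    (hUV : MapsTo f U V) :
    IsDiffAux.{u, v, max u v} 𝕜 c k U (fun x => g (f x)) := by
  induction k generalizing E F with
  | zero => exact LevelCond.comp hg hf hUV
  | succ k ih =>
    -- The inner map (f(x), f^{[1]}(x,y,t), t) of the differentiated composition contains `f`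
    -- itself, which is needed here in order `k` only.
    have hf' := hf.of_succ
    obtain ⟨hf0, f₁, hf₁, hf1⟩ := hf
    obtain ⟨hg0, g₁, hg₁, hg1⟩ := hg
    refine ⟨hg0.comp hf0 hUV, _, hg₁.comp hf₁ hf0.1 hUV, ?_⟩
    refine ih hg1 (IsDiffAux.prodMk ?_ (IsDiffAux.prodMk hf1 ?_)) (hf₁.mapsTo hUV)
    · exact hf'.comp_clm (ContinuousLinearMap.fst 𝕜 E (E × 𝕜)) fun z hz => hz.1
    · exact IsDiffAux.clm c k _ ((ContinuousLinearMap.snd 𝕜 E 𝕜).comp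
        (ContinuousLinearMap.snd 𝕜 E (E × 𝕜)))

end ChainRule

/-! ### Sets with dense interior and their difference quotient domains. -/

section DenseInterior

theorem HasDenseInterior.inter_isOpen {E : Type*} [TopologicalSpace E] {P O : Set E}
    (hP : HasDenseInterior P) (hO : IsOpen O) : HasDenseInterior (P ∩ O) := by
  rintro x ⟨hxP, hxO⟩
  rw [interior_inter, hO.interior_eq]
  exact hO.closure_inter ⟨hP hxP, hxO⟩

theorem HasDenseInterior.preimage_homeomorph {E E' : Type*} [TopologicalSpace E]
    [TopologicalSpace E'] {P : Set E} (hP : HasDenseInterior P) (e : E' ≃ₜ E) :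
    HasDenseInterior (e ⁻¹' P) := by
  unfold HasDenseInterior
  rw [← e.preimage_interior, ← e.preimage_closure]
  exact preimage_mono hP

variable {𝕜 : Type*} [NontriviallyNormedField 𝕜]
  {E : Type*} [AddCommGroup E] [Module 𝕜 E] [TopologicalSpace E] [IsTopologicalAddGroup E]
  [ContinuousSMul 𝕜 E]

theorem HasDenseInterior.dq_domain {Q : Set E} (hQ : HasDenseInterior Q) :
    HasDenseInterior (dqDomain 𝕜 Q) := by
  rintro ⟨x, y, t⟩ ⟨hx, hxy⟩
  have hsub : dqDomain 𝕜 (interior Q) ⊆ interior (dqDomain 𝕜 Q) := by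
    refine interior_maximal (fun z hz => ⟨interior_subset hz.1, interior_subset hz.2⟩) ?_
    exact (isOpen_interior.preimage continuous_fst).inter (isOpen_interior.preimage
      (show Continuous fun z : E × E × 𝕜 => z.1 + z.2.2 • z.2.1 by fun_prop))
  refine closure_mono hsub ?_
  by_cases ht : t = 0
  · subst ht
    refine map_mem_closure (f := fun x : E => (x, y, (0 : 𝕜))) (by fun_prop) (hQ hx) ?_
    intro a ha
    exact ⟨ha, by simpa using ha⟩
  -- For fixed t ≠ 0 the pair (x, x + t y) determines y, so both endpoints can be moved into the
  -- interior independently.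
  · have h2 : (x, x + t • y) ∈ closure (interior Q ×ˢ interior Q) := by
      rw [closure_prod_eq]
      exact ⟨hQ hx, hQ hxy⟩
    have h3 := map_mem_closure (t := dqDomain 𝕜 (interior Q))
      (f := fun z : E × E => (z.1, t⁻¹ • (z.2 - z.1), t)) (by fun_prop) h2 (by
        rintro ⟨a, b⟩ ⟨ha, hb⟩
        refine ⟨ha, ?_⟩
        simpa [smul_smul, mul_inv_cancel₀ ht] using hb)
    simpa [smul_smul, inv_mul_cancel₀ ht] using h3

/-- The points with `t ≠ 0` are dense in the domain of the extended difference quotient. -/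
theorem HasDenseInterior.mem_closure_dqDomain_ne_zero {Q : Set E} (hQ : HasDenseInterior Q)
    {z : E × E × 𝕜} (hz : z ∈ dqDomain 𝕜 Q) :
    z ∈ closure (dqDomain 𝕜 Q ∩ {z | z.2.2 ≠ 0}) := by
  obtain ⟨x, y, t⟩ := z
  by_cases ht : t = 0
  · subst ht
    -- Two approximations in succession: move x into the interior, then replace t = 0 by small
    -- nonzero scalars.
    rw [← closure_closure]
    refine map_mem_closure (f := fun x : E => (x, y, (0 : 𝕜))) (by fun_prop) (hQ hz.1) ?_
    intro a ha
    refine mem_closure_of_tendsto (b := 𝓝[≠] (0 : 𝕜)) (f := fun s => (a, y, s)) ?_ ?_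
    · have : Continuous fun s : 𝕜 => (a, y, s) := by fun_prop
      exact (this.tendsto 0).mono_left nhdsWithin_le_nhds
    · have hc : Continuous fun s : 𝕜 => a + s • y := by fun_prop
      have h1 : ∀ᶠ s in 𝓝[≠] (0 : 𝕜), a + s • y ∈ interior Q :=
        nhdsWithin_le_nhds (hc.continuousAt.eventually
          (isOpen_interior.mem_nhds (by simpa using ha)))
      filter_upwards [h1, self_mem_nhdsWithin] with s hs hs0
      exact ⟨⟨interior_subset ha, interior_subset hs⟩, hs0⟩
  · exact subset_closure ⟨hz, ht⟩

end DenseInterior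

/-! ### Regularity of fixed points at order zero and strict differentiability. -/

/-- `φ p` is a fixed point of the contraction `f (p, ·)` on the slice of `D` at `p`, for all
`p ∈ Q`, where `D` is open in `Q × F`. -/
structure IsFixedPointMap {E F : Type*} [TopologicalSpace E] [NormedAddCommGroup F] (θ : ℝ)
    (Q : Set E) (D : Set (E × F)) (f : E × F → F) (φ : E → F) : Prop where
  nonneg : 0 ≤ θ
  lt_one : θ < 1
  relOpen : ∃ O : Set (E × F), IsOpen O ∧ D = {z | z.1 ∈ Q} ∩ O
  contr : ∀ p x y, (p, x) ∈ D → (p, y) ∈ D → ‖f (p, x) - f (p, y)‖ ≤ θ * ‖x - y‖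
  mem : ∀ p ∈ Q, (p, φ p) ∈ D
  fixed : ∀ p ∈ Q, f (p, φ p) = φ p

/-- `D` restricts only the parameter; in the F-direction it is open, so plain convergence suffices
there. -/
theorem tendsto_nhdsWithin_of_relOpen {E F : Type*} [TopologicalSpace E] [TopologicalSpace F]
    {Q : Set E} {D : Set (E × F)} (h : ∃ O : Set (E × F), IsOpen O ∧ D = {z | z.1 ∈ Q} ∩ O)
    {p : E} {x : F} (hz : (p, x) ∈ D) {ι : Type*} {l : Filter ι} {a : ι → E} {b : ι → F}
    (ha : Tendsto a l (𝓝[Q] p)) (hb : Tendsto b l (𝓝 x)) :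
    Tendsto (fun i => (a i, b i)) l (𝓝[D] (p, x)) := by
  obtain ⟨O, hO, rfl⟩ := h
  have h1 : Tendsto (fun i => (a i, b i)) l (𝓝 (p, x)) :=
    (tendsto_nhds_of_tendsto_nhdsWithin ha).prodMk_nhds hb
  refine tendsto_nhdsWithin_iff.2 ⟨h1, ?_⟩
  filter_upwards [(tendsto_nhdsWithin_iff.1 ha).2, h1.eventually (hO.mem_nhds hz.2)] with i h2 h3
  exact ⟨h2, h3⟩

namespace IsFixedPointMap

section

variable {E F : Type*} [TopologicalSpace E] [NormedAddCommGroup F] {θ : ℝ}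
  {Q : Set E} {D : Set (E × F)} {f : E × F → F} {φ : E → F}

/-- Insert f(p, φ(q)) between the two fixed points and absorb the term θ ‖φ(p) - φ(q)‖ on the left.
-/
theorem norm_sub_le (h : IsFixedPointMap θ Q D f φ) {p q : E} (hp : p ∈ Q) (hq : q ∈ Q)
    (hpq : (p, φ q) ∈ D) : ‖φ p - φ q‖ ≤ (1 - θ)⁻¹ * ‖f (p, φ q) - f (q, φ q)‖ := by
  have h1 : 0 < 1 - θ := sub_pos.2 h.lt_one
  rw [← div_eq_inv_mul, le_div_iff₀ h1]
  have h2 := h.contr p _ _ (h.mem p hp) hpq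
  have h3 : ‖φ p - φ q‖ ≤ ‖f (p, φ p) - f (p, φ q)‖ + ‖f (p, φ q) - f (q, φ q)‖ := by
    calc ‖φ p - φ q‖ = ‖f (p, φ p) - f (q, φ q)‖ := by rw [h.fixed p hp, h.fixed q hq]
      _ ≤ _ := norm_sub_le_norm_sub_add_norm_sub _ _ _
  linarith

theorem continuousOn (h : IsFixedPointMap θ Q D f φ) (hf : ContinuousOn f D) :
    ContinuousOn φ Q := by
  intro p hp
  have h1 : Tendsto (fun q => (q, φ p)) (𝓝[Q] p) (𝓝[D] (p, φ p)) :=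
    tendsto_nhdsWithin_of_relOpen h.relOpen (h.mem p hp) tendsto_id tendsto_const_nhds
  have h2 : Tendsto (fun q => f (q, φ p)) (𝓝[Q] p) (𝓝 (f (p, φ p))) :=
    (hf _ (h.mem p hp)).tendsto.comp h1
  rw [ContinuousWithinAt, tendsto_iff_norm_sub_tendsto_zero]
  have h3 : Tendsto (fun q => (1 - θ)⁻¹ * ‖f (q, φ p) - f (p, φ p)‖) (𝓝[Q] p) (𝓝 0) := by
    simpa using (tendsto_iff_norm_sub_tendsto_zero.1 h2).const_mul (1 - θ)⁻¹
  refine squeeze_zero' (Eventually.of_forall fun _ => norm_nonneg _) ?_ h3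
  filter_upwards [self_mem_nhdsWithin, (tendsto_nhdsWithin_iff.1 h1).2] with q hq hqD
  exact h.norm_sub_le hq hp hqD

end

section

variable {𝕜 : Type*} [NontriviallyNormedField 𝕜]
  {E : Type*} [AddCommGroup E] [Module 𝕜 E] [TopologicalSpace E] [IsTopologicalAddGroup E]
  {F : Type*} [NormedAddCommGroup F] [NormedSpace 𝕜 F] {θ : ℝ}
  {Q : Set E} {D : Set (E × F)} {f : E × F → F} {φ : E → F}

/-- The partial derivative in the second variable of a family of contractions has operator norm
at most the contraction constant. -/
theorem norm_partial_le (h : IsFixedPointMap θ Q D f φ) {p : E} {x : F} (hpx : (p, x) ∈ D)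
    {f' : E × F →L[𝕜] F} {η : E × F → ℝ} (hη : IsGauge 𝕜 η)
    (hf' : ∀ ε : ℝ, 0 < ε → ∃ δ : ℝ, 0 < δ ∧
      ∀ y ∈ D, ∀ z ∈ D, η (z - (p, x)) < δ → η (y - (p, x)) < δ →
        ‖f z - f y - f' (z - y)‖ ≤ ε * η (z - y)) (y : F) :
    ‖f' (0, y)‖ ≤ θ * ‖y‖ := by
  -- Compare the increments along s(0, y) with the contraction estimate and cancel ‖s‖. Since η(0,
  -- y) does not depend on `ε`, letting `ε` tend to 0 gives the bound.
  have key : ∀ ε : ℝ, 0 < ε → ‖f' (0, y)‖ ≤ θ * ‖y‖ + ε * η (0, y) := by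
    intro ε hε
    obtain ⟨δ, hδ, H⟩ := hf' ε hε
    have hc : Tendsto (fun s : 𝕜 => x + s • y) (𝓝[≠] 0) (𝓝 x) := by
      have : Continuous fun s : 𝕜 => x + s • y := by fun_prop
      simpa using (this.tendsto 0).mono_left nhdsWithin_le_nhds
    have hpQ : p ∈ Q := by
      obtain ⟨O, -, rfl⟩ := h.relOpen
      exact hpx.1
    have t1 : Tendsto (fun s : 𝕜 => (p, x + s • y)) (𝓝[≠] 0) (𝓝[D] (p, x)) :=
      tendsto_nhdsWithin_of_relOpen h.relOpen hpx
        (tendsto_nhdsWithin_iff.2 ⟨tendsto_const_nhds, Eventually.of_forall fun _ => hpQ⟩) hc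
    obtain ⟨s, hs0, hsD, hsη⟩ := ((eventually_mem_nhdsWithin (a := (0 : 𝕜)) (s := {0}ᶜ)).and
      ((tendsto_nhdsWithin_iff.1 t1).2.and ((tendsto_nhdsWithin_iff.1 t1).1.eventually
        (hη.eventually_sub_lt (p, x) hδ)))).exists
    have hs : 0 < ‖s‖ := norm_pos_iff.2 hs0
    have e1 := H (p, x) hpx _ hsD hsη (by rwa [sub_self, hη.map_zero])
    have e2 := h.contr p _ _ hsD hpx
    have e3 : (p, x + s • y) - (p, x) = s • ((0 : E), y) := by simp
    rw [e3, map_smul, hη.smul] at e1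
    rw [add_sub_cancel_left, norm_smul] at e2
    have e4 : ‖s‖ * ‖f' (0, y)‖ ≤ ‖s‖ * (θ * ‖y‖ + ε * η (0, y)) := by
      rw [← norm_smul]
      calc ‖s • f' (0, y)‖
          = ‖(f (p, x + s • y) - f (p, x)) - (f (p, x + s • y) - f (p, x) - s • f' (0, y))‖ := by
            rw [sub_sub_cancel]
        _ ≤ _ := _root_.norm_sub_le _ _
        _ ≤ _ := by linarith
    exact le_of_mul_le_mul_left e4 hs
  refine le_of_forall_pos_le_add fun ε hε => ?_
  have hn := hη.nonneg (0, y)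
  have := key (ε / (η (0, y) + 1)) (by positivity)
  have h2 : ε / (η (0, y) + 1) * η (0, y) ≤ ε := by
    rw [div_mul_eq_mul_div, div_le_iff₀ (by positivity)]
    nlinarith
  linarith

variable [ContinuousSMul 𝕜 E]

theorem lipschitzContOn (h : IsFixedPointMap θ Q D f φ) (hfc : ContinuousOn f D)
    (hf : LipschitzContOn 𝕜 D f) : LipschitzContOn 𝕜 Q φ := by
  rw [lipschitzContOn_iff_eventually] at *
  intro p hp γ hγ
  obtain ⟨C, hC, hγC⟩ := hγ.le_const_mul_norm
  obtain ⟨η, hη, H⟩ := hf _ (h.mem p hp) _ isGauge_norm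
  have h1 : 0 < (1 - θ)⁻¹ := inv_pos.2 (sub_pos.2 h.lt_one)
  refine ⟨_, (hη.comp_clm (ContinuousLinearMap.inl 𝕜 E F)).const_mul (mul_pos hC h1), ?_⟩
  have hφ : Tendsto (fun z : E × E => φ z.1) (𝓝[Q] p ×ˢ 𝓝[Q] p) (𝓝 (φ p)) :=
    (h.continuousOn hfc p hp).tendsto.comp tendsto_fst
  have t1 := tendsto_nhdsWithin_of_relOpen h.relOpen (h.mem p hp)
    (tendsto_fst (f := 𝓝[Q] p) (g := 𝓝[Q] p)) hφ
  have t2 := tendsto_nhdsWithin_of_relOpen h.relOpen (h.mem p hp)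
    (tendsto_snd (f := 𝓝[Q] p) (g := 𝓝[Q] p)) hφ
  have hQ : ∀ᶠ q in 𝓝[Q] p, q ∈ Q := eventually_mem_nhdsWithin
  filter_upwards [(t1.prodMk t2).eventually H, hQ.prod_mk hQ, (tendsto_nhdsWithin_iff.1 t2).2]
    with z hz hzQ hzD
  calc γ (φ z.2 - φ z.1) ≤ C * ‖φ z.2 - φ z.1‖ := hγC _
    _ ≤ C * ((1 - θ)⁻¹ * ‖f (z.2, φ z.1) - f (z.1, φ z.1)‖) := by
      gcongr
      exact h.norm_sub_le hzQ.2 hzQ.1 hzD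
    _ ≤ C * ((1 - θ)⁻¹ * η ((z.2, φ z.1) - (z.1, φ z.1))) := by gcongr
    _ = _ := by simp [mul_assoc]

/-- With B the partial derivative in F, the fixed point equation gives φ(r) - φ(q) ≈ f'(r - q, 0) +
B(φ(r) - φ(q)). As ‖B‖ < 1, this can be solved for φ(r) - φ(q) by applying (1 - B)⁻¹. -/
theorem strictDiffOn [CompleteSpace F] (h : IsFixedPointMap θ Q D f φ) (hfc : ContinuousOn f D)
    (hf : StrictDiffOn 𝕜 D f) : StrictDiffOn 𝕜 Q φ := by
  intro p hp
  obtain ⟨f', hf'⟩ := hf _ (h.mem p hp)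
  obtain ⟨η, hη, H⟩ := hf' _ isGauge_norm
  obtain ⟨ζ, hζ, δ₀, hδ₀, HL⟩ :=
    h.lipschitzContOn hfc hf.lipschitzContOn p hp _ (isGauge_norm (𝕜 := 𝕜))
  let B : F →L[𝕜] F := f'.comp (ContinuousLinearMap.inr 𝕜 E F)
  have hB : ‖B‖ < 1 := (B.opNorm_le_bound h.nonneg
    (fun y => h.norm_partial_le (h.mem p hp) hη H y)).trans_lt h.lt_one
  let S : (F →L[𝕜] F)ˣ := Units.oneSub B hB
  let T : F →L[𝕜] F := ↑S⁻¹
  have hT : ∀ y, T (y - B y) = y := by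
    intro y
    have h1 : T * (1 - B) = 1 := S.inv_mul
    have := congrArg (fun A : F →L[𝕜] F => A y) h1
    simpa using this
  refine ⟨T.comp (f'.comp (ContinuousLinearMap.inl 𝕜 E F)), fun γ hγ => ?_⟩
  obtain ⟨C, hC, hγC⟩ := hγ.le_const_mul_norm
  obtain ⟨η₁, hη₁, η₂, hη₂, hη12⟩ := hη.exists_prod_le
  obtain ⟨C₂, hC₂, hη₂C⟩ := hη₂.le_const_mul_norm
  -- `ξ` bounds increments along the graph of `φ`; its second term comes from the Lipschitz estimate
  -- for `φ`, valid where `ζ` is below `δ₀`.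
  let ξ : E → ℝ := fun x => max (η₁ x) (C₂ * ζ x)
  have hξ : IsGauge 𝕜 ξ := hη₁.sup (hζ.const_mul hC₂)
  have hbound : ∀ q ∈ Q, ∀ r ∈ Q, ζ (q - p) < δ₀ → ζ (r - p) < δ₀ →
      η ((r, φ r) - (q, φ q)) ≤ ξ (r - q) := by
    intro q hq r hr hqδ hrδ
    refine (hη12 _ _).trans (max_le_max le_rfl ((hη₂C _).trans ?_))
    exact mul_le_mul_of_nonneg_left (HL q hq r hr hqδ hrδ) hC₂.le
  refine ⟨_, hξ.sup hζ, fun ε hε => ?_⟩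
  have hK : 0 < C * (‖T‖ + 1) := by positivity
  -- The error passes through `T` and then through γ ≤ C‖·‖; the summand 1 keeps the denominator
  -- positive when `T` is zero.
  obtain ⟨δ₁, hδ₁, H⟩ := H (ε / (C * (‖T‖ + 1))) (by positivity)
  refine ⟨min δ₀ δ₁, by positivity, fun q hq r hr hr1 hq1 => ?_⟩
  simp only [lt_min_iff, max_lt_iff] at hr1 hq1
  have hp0 : ζ (p - p) < δ₀ := by rwa [sub_self, hζ.map_zero]
  have e1 := H _ (h.mem q hq) _ (h.mem r hr)
    ((hbound p hp r hr hp0 hr1.1.2).trans_lt hr1.2.1)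
    ((hbound p hp q hq hp0 hq1.1.2).trans_lt hq1.2.1)
  have e2 := hbound q hq r hr hq1.1.2 hr1.1.2
  rw [h.fixed q hq, h.fixed r hr] at e1
  have e3 : φ r - φ q - (T.comp (f'.comp (ContinuousLinearMap.inl 𝕜 E F))) (r - q)
      = T (φ r - φ q - f' ((r, φ r) - (q, φ q))) := by
    have : f' ((r, φ r) - (q, φ q)) = f' (r - q, 0) + B (φ r - φ q) := by
      rw [show B (φ r - φ q) = f' (0, φ r - φ q) from rfl, ← map_add]
      simp
    rw [this, add_comm, ← sub_sub, map_sub T, hT]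
    rfl
  rw [e3]
  calc γ (T (φ r - φ q - f' ((r, φ r) - (q, φ q))))
      ≤ C * (‖T‖ * ‖φ r - φ q - f' ((r, φ r) - (q, φ q))‖) :=
        (hγC _).trans (mul_le_mul_of_nonneg_left (T.le_opNorm _) hC.le)
    _ ≤ C * ((‖T‖ + 1) * (ε / (C * (‖T‖ + 1)) * ξ (r - q))) := by
        have := hξ.nonneg (r - q)
        gcongr
        · exact le_add_of_nonneg_right zero_le_one
        · exact e1.trans (by gcongr)
    _ = ε * ξ (r - q) := by field_simp
    _ ≤ _ := mul_le_mul_of_nonneg_left (le_max_left _ _) hε.le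

theorem levelCond [CompleteSpace F] (h : IsFixedPointMap θ Q D f φ) {c : DiffKind} {k : ℕ}
    (hf : LevelCond 𝕜 c k D f) : LevelCond 𝕜 c k Q φ := by
  refine ⟨h.continuousOn hf.1, ?_⟩
  match c, hf with
  | .C, _ => trivial
  | .SC, hf => exact fun hr => h.strictDiffOn hf.1 (hf.2 hr)
  | .LC, hf => exact h.lipschitzContOn hf.1 hf.2

end

end IsFixedPointMap

/-! ### The family of contractions that governs the difference quotient of φ. -/

section ParamQuot

variable {𝕜 : Type*} [NontriviallyNormedField 𝕜]
  {E : Type*} [AddCommGroup E] [Module 𝕜 E] {F : Type*} [AddCommGroup F] [Module 𝕜 F]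

/-- The domain of the family of contractions whose fixed points are the values of the extended
difference quotient of `φ`. -/
def quotFamilyDomain (𝕜 : Type*) [NontriviallyNormedField 𝕜] {E : Type*} [AddCommGroup E]
    [Module 𝕜 E] {F : Type*} [AddCommGroup F] [Module 𝕜 F] (Q : Set E) (D : Set (E × F))
    (φ : E → F) : Set ((E × E × 𝕜) × F) :=
  {z | z.1 ∈ dqDomain 𝕜 Q ∧
    (z.1.1 + z.1.2.2 • z.1.2.1, φ z.1.1 + z.1.2.2 • z.2) ∈ D}

/-- The point at which `f^{[1]}` is evaluated in the family of contractions for the extended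
difference quotient of `φ`. -/
def quotFamilyArg {𝕜 E F : Type*} (φ : E → F) (z : (E × E × 𝕜) × F) :
    (E × F) × (E × F) × 𝕜 :=
  ((z.1.1, φ z.1.1), (z.1.2.1, z.2), z.1.2.2)

theorem quotFamilyArg_mapsTo {Q : Set E} {D : Set (E × F)} {φ : E → F}
    (h : ∀ p ∈ Q, (p, φ p) ∈ D) :
    MapsTo (quotFamilyArg φ) (quotFamilyDomain 𝕜 Q D φ) (dqDomain 𝕜 D) :=
  fun _ hz => ⟨h _ hz.1.1, hz.2⟩

end ParamQuot

namespace IsFixedPointMap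

section

variable {𝕜 : Type*} [NontriviallyNormedField 𝕜]
  {E : Type*} [AddCommGroup E] [Module 𝕜 E] [TopologicalSpace E]
  {F : Type*} [NormedAddCommGroup F] [NormedSpace 𝕜 F] {θ : ℝ}
  {Q : Set E} {D : Set (E × F)} {f : E × F → F} {φ : E → F}

theorem continuousOn_quotFamily (h : IsFixedPointMap θ Q D f φ) (hφ : ContinuousOn φ Q)
    {f₁ : (E × F) × (E × F) × 𝕜 → F} (hf₁ : IsExtDiffQuot 𝕜 D f f₁) :
    ContinuousOn (fun z => f₁ (quotFamilyArg φ z)) (quotFamilyDomain 𝕜 Q D φ) := by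
  refine hf₁.cont.comp ?_ (quotFamilyArg_mapsTo h.mem)
  refine ContinuousOn.prodMk (ContinuousOn.prodMk (by fun_prop) ?_) (by fun_prop)
  exact hφ.comp (by fun_prop) fun z hz => hz.1.1

variable [IsTopologicalAddGroup E] [ContinuousSMul 𝕜 E]

theorem relOpen_quotFamilyDomain (h : IsFixedPointMap θ Q D f φ) (hφ : ContinuousOn φ Q) :
    ∃ O : Set ((E × E × 𝕜) × F), IsOpen O ∧
      quotFamilyDomain 𝕜 Q D φ = {z | z.1 ∈ dqDomain 𝕜 Q} ∩ O := by
  obtain ⟨O, hO, hD⟩ := h.relOpen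
  have hc : ContinuousOn (fun z : (E × E × 𝕜) × F =>
      (z.1.1 + z.1.2.2 • z.1.2.1, φ z.1.1 + z.1.2.2 • z.2)) {z | z.1 ∈ dqDomain 𝕜 Q} := by
    refine ContinuousOn.prodMk (by fun_prop) (ContinuousOn.add ?_ (by fun_prop))
    exact hφ.comp (by fun_prop) fun z hz => hz.1
  obtain ⟨O', hO', h'⟩ := continuousOn_iff'.1 hc O hO
  refine ⟨O', hO', ?_⟩
  rw [inter_comm, ← h']
  ext z
  simp only [quotFamilyDomain, hD, mem_ofPred_eq, mem_inter_iff, mem_preimage]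
  constructor
  · rintro ⟨h1, -, h2⟩
    exact ⟨h2, h1⟩
  · rintro ⟨h2, h1⟩
    exact ⟨h1, h1.2, h2⟩

/-- For t ≠ 0 the values at x and y differ by t⁻¹ times an increment of f between points t(x - y)
apart, so t cancels and θ survives. The case t = 0 follows by continuity, as points with t ≠ 0 are
dense. -/
theorem contr_quotFamily (h : IsFixedPointMap θ Q D f φ) (hQ : HasDenseInterior Q)
    (hφ : ContinuousOn φ Q) {f₁ : (E × F) × (E × F) × 𝕜 → F} (hf₁ : IsExtDiffQuot 𝕜 D f f₁)
    (z : E × E × 𝕜) (x y : F) (hx : (z, x) ∈ quotFamilyDomain 𝕜 Q D φ)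
    (hy : (z, y) ∈ quotFamilyDomain 𝕜 Q D φ) :
    ‖f₁ (quotFamilyArg φ (z, x)) - f₁ (quotFamilyArg φ (z, y))‖ ≤ θ * ‖x - y‖ := by
  set l := 𝓝[dqDomain 𝕜 Q ∩ {z | z.2.2 ≠ 0}] z with hl
  have : l.NeBot := mem_closure_iff_nhdsWithin_neBot.1 (hQ.mem_closure_dqDomain_ne_zero hx.1)
  have ht : ∀ {b : F}, (z, b) ∈ quotFamilyDomain 𝕜 Q D φ →
      Tendsto (fun a => (a, b)) l (𝓝[quotFamilyDomain 𝕜 Q D φ] (z, b)) := fun hb =>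
    tendsto_nhdsWithin_of_relOpen (h.relOpen_quotFamilyDomain hφ) hb
      (tendsto_id.mono_left (nhdsWithin_mono _ inter_subset_left)) tendsto_const_nhds
  have hc := h.continuousOn_quotFamily hφ hf₁
  refine le_of_tendsto (((hc _ hx).tendsto.comp (ht hx)).sub
    ((hc _ hy).tendsto.comp (ht hy))).norm ?_
  filter_upwards [(tendsto_nhdsWithin_iff.1 (ht hx)).2, (tendsto_nhdsWithin_iff.1 (ht hy)).2,
    self_mem_nhdsWithin] with a hax hay ha
  obtain ⟨p, q, t⟩ := a
  have ht0 : t ≠ 0 := ha.2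
  have ht' : 0 < ‖t‖ := norm_pos_iff.2 ht0
  simp only [Function.comp_apply, quotFamilyArg]
  rw [hf₁.eq _ _ _ ht0 (quotFamilyArg_mapsTo h.mem hax),
    hf₁.eq _ _ _ ht0 (quotFamilyArg_mapsTo h.mem hay), ← smul_sub, sub_sub_sub_cancel_right,
    norm_smul, norm_inv, inv_mul_le_iff₀ ht']
  refine (h.contr _ _ _ hax.2 hay.2).trans_eq ?_
  simp only [add_sub_add_left_eq_sub, ← smul_sub, norm_smul]
  ring

/-- The extended difference quotient of the fixed point map is a fixed point map again. -/
theorem exists_quot [CompleteSpace F] (h : IsFixedPointMap θ Q D f φ) (hQ : HasDenseInterior Q)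
    (hφ : ContinuousOn φ Q) {f₁ : (E × F) × (E × F) × 𝕜 → F} (hf₁ : IsExtDiffQuot 𝕜 D f f₁) :
    ∃ φ₁ : E × E × 𝕜 → F, IsExtDiffQuot 𝕜 Q φ φ₁ ∧
      IsFixedPointMap θ (dqDomain 𝕜 Q) (quotFamilyDomain 𝕜 Q D φ)
        (fun z => f₁ (quotFamilyArg φ z)) φ₁ := by
  have key : ∀ z ∈ dqDomain 𝕜 Q, ∃ y, (z, y) ∈ quotFamilyDomain 𝕜 Q D φ ∧
      f₁ (quotFamilyArg φ (z, y)) = y ∧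
      (z.2.2 ≠ 0 → y = z.2.2⁻¹ • (φ (z.1 + z.2.2 • z.2.1) - φ z.1)) := by
    rintro ⟨p, q, t⟩ hz
    by_cases ht : t = 0
    · subst ht
      -- At t = 0 the slice is all of F, a complete space mapped to itself, so Banach's theorem
      -- applies without an invariance condition.
      have hD : ∀ y, ((p, q, (0 : 𝕜)), y) ∈ quotFamilyDomain 𝕜 Q D φ := fun y =>
        ⟨hz, by simpa using h.mem p hz.1⟩
      have hcw : ContractingWith ⟨θ, h.nonneg⟩
          (fun y => f₁ (quotFamilyArg φ ((p, q, (0 : 𝕜)), y))) := by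
        refine ⟨by exact_mod_cast h.lt_one, LipschitzWith.of_dist_le_mul fun x y => ?_⟩
        rw [dist_eq_norm, dist_eq_norm]
        exact h.contr_quotFamily hQ hφ hf₁ _ x y (hD x) (hD y)
      exact ⟨_, hD _, hcw.fixedPoint_isFixedPt, fun h => absurd rfl h⟩
    · refine ⟨t⁻¹ • (φ (p + t • q) - φ p), ?_, ?_, fun _ => rfl⟩
      · refine ⟨hz, ?_⟩
        simpa [smul_smul, mul_inv_cancel₀ ht] using h.mem _ hz.2
      · have hm : ((p, φ p), (q, t⁻¹ • (φ (p + t • q) - φ p)), t) ∈ dqDomain 𝕜 D := by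
          refine ⟨h.mem p hz.1, ?_⟩
          simpa [smul_smul, mul_inv_cancel₀ ht] using h.mem _ hz.2
        simp only [quotFamilyArg]
        rw [hf₁.eq _ _ _ ht hm, h.fixed p hz.1]
        have : (p, φ p) + t • (q, t⁻¹ • (φ (p + t • q) - φ p)) = (p + t • q, φ (p + t • q)) := by
          simp [smul_smul, mul_inv_cancel₀ ht]
        rw [this, h.fixed _ hz.2]
  choose! φ₁ hmem hfix heq using key
  have hφ₁ : IsFixedPointMap θ (dqDomain 𝕜 Q) (quotFamilyDomain 𝕜 Q D φ)
      (fun z => f₁ (quotFamilyArg φ z)) φ₁ :=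
    ⟨h.nonneg, h.lt_one, h.relOpen_quotFamilyDomain hφ, h.contr_quotFamily hQ hφ hf₁, hmem, hfix⟩
  -- Continuity of `φ₁`, including at t = 0, is an instance of continuous dependence of fixed points
  -- on parameters.
  exact ⟨φ₁, ⟨hφ₁.continuousOn (h.continuousOn_quotFamily hφ hf₁),
    fun x y t ht hz => heq _ hz ht⟩, hφ₁⟩

end

variable {𝕜 : Type u} [NontriviallyNormedField 𝕜]
  {E : Type (max u v)} [AddCommGroup E] [Module 𝕜 E] [TopologicalSpace E]
  [IsTopologicalAddGroup E] [ContinuousSMul 𝕜 E]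
  {F : Type (max u v)} [NormedAddCommGroup F] [NormedSpace 𝕜 F] [CompleteSpace F]

theorem isDiffAux {θ : ℝ} {Q : Set E} {D : Set (E × F)} {f : E × F → F} {φ : E → F}
    (h : IsFixedPointMap θ Q D f φ) (hQ : HasDenseInterior Q) {c : DiffKind} {k : ℕ}
    (hf : IsDiffAux.{u, v, max u v} 𝕜 c k D f) : IsDiffAux.{u, v, max u v} 𝕜 c k Q φ := by
  induction k generalizing E with
  | zero => exact h.levelCond hf
  | succ k ih =>
    -- The induction hypothesis is used twice: here for `φ` in order `k`, so that the new family,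
    -- which involves `φ`, is of order `k`; then for `φ₁` as the fixed point map of that family.
    have hφ := ih h hQ hf.of_succ
    obtain ⟨hf0, f₁, hf₁, hf1⟩ := hf
    have hφ0 := h.levelCond hf0
    obtain ⟨φ₁, hφ₁, h₁⟩ := h.exists_quot hQ hφ0.1 hf₁
    refine ⟨hφ0, φ₁, hφ₁, ih h₁ hQ.dq_domain ?_⟩
    refine hf1.comp ?_ (quotFamilyArg_mapsTo h.mem)
    let π₁ := ContinuousLinearMap.fst 𝕜 (E × E × 𝕜) F
    let π₂ := ContinuousLinearMap.snd 𝕜 (E × E × 𝕜) F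
    let ρ₁ := (ContinuousLinearMap.fst 𝕜 E (E × 𝕜)).comp π₁
    let ρ₂ := (ContinuousLinearMap.snd 𝕜 E (E × 𝕜)).comp π₁
    refine IsDiffAux.prodMk (IsDiffAux.prodMk (IsDiffAux.clm c k _ ρ₁) ?_)
      (IsDiffAux.clm c k _ ((((ContinuousLinearMap.fst 𝕜 E 𝕜).comp ρ₂).prod π₂).prod
        ((ContinuousLinearMap.snd 𝕜 E 𝕜).comp ρ₂)))
    exact hφ.comp_clm ρ₁ fun z hz => hz.1.1

end IsFixedPointMap

/-! ### Uniqueness of fixed points and openness of the set of admissible parameters. -/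

section Parameters

variable {E F : Type*} [NormedAddCommGroup F] {P : Set E} {U : Set F} {f : E × F → F}

theorem IsUniformContractionFamily.unique_fixed (hcontr : IsUniformContractionFamily P U f)
    {p : E} (hp : p ∈ P) {x y : F} (hx : x ∈ U) (hy : y ∈ U) (hfx : f (p, x) = x)
    (hfy : f (p, y) = y) : x = y := by
  obtain ⟨θ, -, hθ1, h⟩ := hcontr
  have := h p hp x hx y hy
  rw [hfx, hfy] at this
  rw [← sub_eq_zero, ← norm_eq_zero]
  nlinarith [norm_nonneg (x - y)]

variable [TopologicalSpace E]

theorem IsUniformContractionFamily.fixedParams_mem_nhdsWithin [CompleteSpace F]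
    (hcontr : IsUniformContractionFamily P U f) (hU : IsOpen U) (hf : ContinuousOn f (P ×ˢ U))
    {p : E} (hp : p ∈ fixedParams P U f) : fixedParams P U f ∈ 𝓝[P] p := by
  obtain ⟨θ, hθ0, hθ1, h⟩ := hcontr
  obtain ⟨hpP, x, hxU, hx⟩ := hp
  obtain ⟨r, hr, hrU⟩ := Metric.nhds_basis_closedBall.mem_iff.1 (hU.mem_nhds hxU)
  have h1 : Tendsto (fun q => f (q, x)) (𝓝[P] p) (𝓝 x) := by
    have hc : ContinuousOn (fun q => f (q, x)) P :=
      hf.comp (by fun_prop) fun q hq => ⟨hq, hxU⟩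
    simpa [hx] using (hc p hpP).tendsto
  -- If f(q, ·) moves the centre by less than (1 - θ) r, it maps the closed ball of radius r into
  -- itself, because θ r + (1 - θ) r = r.
  have h2 : 0 < (1 - θ) * r := mul_pos (sub_pos.2 hθ1) hr
  filter_upwards [self_mem_nhdsWithin, h1.eventually (Metric.ball_mem_nhds x h2)] with q hq hqx
  have hmaps : MapsTo (fun y => f (q, y)) (Metric.closedBall x r) (Metric.closedBall x r) := by
    intro y hy
    have e1 := h q hq y (hrU hy) x hxU
    rw [mem_closedBall_iff_norm] at hy ⊢
    rw [dist_eq_norm] at hqx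
    have e2 := norm_sub_le_norm_sub_add_norm_sub (f (q, y)) (f (q, x)) x
    nlinarith
  have hcw : ContractingWith ⟨θ, hθ0⟩ (hmaps.restrict _ _ _) := by
    refine ⟨by exact_mod_cast hθ1, LipschitzWith.of_dist_le_mul fun a b => ?_⟩
    rw [Subtype.dist_eq, Subtype.dist_eq, dist_eq_norm, dist_eq_norm]
    exact h q hq a (hrU a.2) b (hrU b.2)
  obtain ⟨y, hy, hfy, -⟩ := hcw.exists_fixedPoint' Metric.isClosed_closedBall.isComplete hmaps
    (Metric.mem_closedBall_self hr.le) (edist_ne_top _ _)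
  exact ⟨hq, y, hrU hy, hfy⟩

theorem IsUniformContractionFamily.exists_isOpen_fixedParams_eq [CompleteSpace F]
    (hcontr : IsUniformContractionFamily P U f) (hU : IsOpen U) (hf : ContinuousOn f (P ×ˢ U)) :
    ∃ O : Set E, IsOpen O ∧ fixedParams P U f = P ∩ O := by
  refine ⟨⋃₀ {O | IsOpen O ∧ O ∩ P ⊆ fixedParams P U f}, isOpen_sUnion fun O hO => hO.1, ?_⟩
  ext p
  constructor
  · intro hp
    obtain ⟨O, hO, hpO, hOP⟩ :=
      mem_nhdsWithin.1 (hcontr.fixedParams_mem_nhdsWithin hU hf hp)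
    exact ⟨hp.1, O, ⟨hO, hOP⟩, hpO⟩
  · rintro ⟨hpP, O, hO, hpO⟩
    exact hO.2 ⟨hpO, hpP⟩

end Parameters

/-! ### Reduction to a common universe and conclusion. -/

/-- The fixed point map inherits finite order differentiability from the family. All spaces are
lifted to a common universe, in which the recursion for `IsDiffAux` takes place. -/
theorem isDiffNat_fixedPoint {𝕜 : Type u} [NontriviallyNormedField 𝕜]
    {E : Type v} [AddCommGroup E] [Module 𝕜 E] [TopologicalSpace E] [IsTopologicalAddGroup E]
    [ContinuousSMul 𝕜 E]
    {F : Type w} [NormedAddCommGroup F] [NormedSpace 𝕜 F] [CompleteSpace F]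
    {P : Set E} (hP : HasDenseInterior P) {U : Set F} (hU : IsOpen U)
    {f : E × F → F} (hf : ContinuousOn f (P ×ˢ U)) (hcontr : IsUniformContractionFamily P U f)
    {φ : E → F} (hφ : ∀ p ∈ fixedParams P U f, φ p ∈ U ∧ f (p, φ p) = φ p)
    {c : DiffKind} {n : ℕ} (hfn : IsDiffNat 𝕜 c n (P ×ˢ U) f) :
    IsDiffNat 𝕜 c n (fixedParams P U f) φ := by
  obtain ⟨O, hO, hQ⟩ := hcontr.exists_isOpen_fixedParams_eq hU hf
  have hQd : HasDenseInterior (fixedParams P U f) := hQ ▸ hP.inter_isOpen hO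
  obtain ⟨θ, hθ0, hθ1, hθ⟩ := hcontr
  let E' := ULift.{max u w} E
  let F' := ULift.{max u v} F
  let e : E' ≃L[𝕜] E := ContinuousLinearEquiv.ulift
  let e' : F' ≃L[𝕜] F := ContinuousLinearEquiv.ulift
  have : ContinuousSMul 𝕜 E' := e.toHomeomorph.isInducing.continuousSMul continuous_id
    (fun {_ _} => map_smul e _ _)
  have : IsTopologicalAddGroup E' := e.toHomeomorph.isInducing.topologicalAddGroup e
  let Q' : Set E' := e ⁻¹' fixedParams P U f
  -- The induction starts from a product domain, with the parameters already restricted to those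
  -- having a fixed point.
  let D' : Set (E' × F') := {z | e z.1 ∈ fixedParams P U f ∧ e' z.2 ∈ U}
  let f' : E' × F' → F' := fun z => e'.symm (f (e z.1, e' z.2))
  let φ' : E' → F' := fun p => e'.symm (φ (e p))
  have h : IsFixedPointMap θ Q' D' f' φ' := by
    refine ⟨hθ0, hθ1, ⟨{z | e' z.2 ∈ U}, hU.preimage (by fun_prop), rfl⟩, ?_, ?_, ?_⟩
    · rintro p x y ⟨hp, hx⟩ ⟨-, hy⟩
      exact hθ (e p) hp.1 (e' x) hx (e' y) hy
    · intro p hp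
      exact ⟨hp, (hφ _ hp).1⟩
    · intro p hp
      exact congrArg e'.symm (hφ _ hp).2
  have hf' : IsDiffAux.{u, max v w, max u v w} 𝕜 c n D' f' :=
    hfn.isDiffAux ((e : E' →L[𝕜] E).prodMap (e' : F' →L[𝕜] F)) (e'.symm : F →L[𝕜] F')
      (fun z hz => ⟨hz.1.1, hz.2⟩) fun _ _ => rfl
  have hφ' := IsFixedPointMap.isDiffAux.{u, max v w} h (hQd.preimage_homeomorph e.toHomeomorph) hf'
  exact hφ'.isDiffNat (e.symm : E →L[𝕜] E') (e' : F' →L[𝕜] F) (fun p hp => hp) fun _ _ => rfl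

theorem theorem4p7 {𝕜 : Type u} [NontriviallyNormedField 𝕜]
    {E : Type v} [AddCommGroup E] [Module 𝕜 E] [TopologicalSpace E] [IsTopologicalAddGroup E]
    [ContinuousSMul 𝕜 E] [T2Space E]
    {F : Type w} [NormedAddCommGroup F] [NormedSpace 𝕜 F] [CompleteSpace F]
    (P : Set E) (hP : HasDenseInterior P) (U : Set F) (hU : IsOpen U)
    (f : E × F → F) (hf : ContinuousOn f (P ×ˢ U))
    (hcontr : IsUniformContractionFamily P U f) :
    (∃ O : Set E, IsOpen O ∧ fixedParams P U f = P ∩ O) ∧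
    (∀ p ∈ fixedParams P U f, ∃! x, x ∈ U ∧ f (p, x) = x) ∧
    ∀ φ : E → F, (∀ p ∈ fixedParams P U f, φ p ∈ U ∧ f (p, φ p) = φ p) →
      ∀ k : ℕ∞,
        (IsDiff 𝕜 .C k (P ×ˢ U) f → IsDiff 𝕜 .C k (fixedParams P U f) φ) ∧
        (IsDiff 𝕜 .SC k (P ×ˢ U) f → IsDiff 𝕜 .SC k (fixedParams P U f) φ) ∧
        (IsDiff 𝕜 .LC k (P ×ˢ U) f → IsDiff 𝕜 .LC k (fixedParams P U f) φ) := by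
  refine ⟨hcontr.exists_isOpen_fixedParams_eq hU hf, ?_, fun φ hφ k => ?_⟩
  · rintro p ⟨hp, x, hxU, hx⟩
    exact ⟨x, ⟨hxU, hx⟩, fun y hy => hcontr.unique_fixed hp hy.1 hxU hy.2 hx⟩
  · have key : ∀ c : DiffKind, IsDiff 𝕜 c k (P ×ˢ U) f → IsDiff 𝕜 c k (fixedParams P U f) φ :=
      fun c h n hn => isDiffNat_fixedPoint hP hU hf hcontr hφ (h n hn)
    exact ⟨key .C, key .SC, key .LC⟩
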